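/- Consider four point vortices in the plane with strengths $\Gamma_1=\Gamma_2=1$ and $\Gamma_3=\Gamma_4=m$, where $m\in(-1,1]$ and $m\neq 0$. Pairwise distinct positions $x_1,\dots,x_4\in\mathbb{R}^2$ form a relative equilibrium with angular velocity $\lambda\ne 0$ if there is $c\in\mathbb{R}^2$ with $$-\lambda(x_i-c)=\sum_{j\neq i}\frac{\Gamma_j}{\|x_i-x_j\|^2}(x_j-x_i)\qquad(i=1,\dots,4).$$ Normalize the scale by $\lambda'=-\lambda/(\Gamma_1+\Gamma_2+\Gamma_3+\Gamma_4)=-1$. Call a configuration strictly planar if its points do not all lie on one line, and asymmetric if no reflection in a line maps the set $\{x_1,\dots,x_4\}$ onto itself. Let $E\subset\mathbb{R}^7$ be the set of all points $(s_{12},s_{13},s_{14},s_{23},s_{24},s_{34},m)$, $s_{ij}=\|x_i-x_j\|^2$, given by the normalized asymmetric strictly planar relative equilibria, for all $m\in(-1,1]$ with $m\ne0$, and let $V$ be the variety of $E$, i.e. the smallest real affine algebraic variety in $\mathbb{R}^7$ that contains $E$. For $p\in V$, let $$T_p(V)=\Big\{v\in\mathbb{R}^7:\ \sum_{i=1}^{7}\frac{\partial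 f}{\partial x_i}(p)\,v_i=0\ \text{ for every polynomial } f \text{ vanishing on } V\Big\},$$ and call $p$ singular if $\dim T_p(V)\neq\dim V$. Theorem. The variety $V$ of the asymmetric strictly planar relative equilibria has dimension one and has no singular points, and hence it is a smooth one-dimensional manifold: $V$ is a one-dimensional $C^\infty$ embedded submanifold of $\mathbb{R}^7$, and so is the set $E$ of the asymmetric strictly planar relative equilibria itself. -/

import Mathlib

open scoped ContDiff

noncomputable section

/-- The Euclidean plane in which the vortices live. -/
abbrev Plane := EuclideanSpace ℝ (Fin 2)

/-- The positions `x` are those of a relative equilibrium of the planar point vortices of strengths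
`Γ`, with angular velocity `lam ≠ 0`: the vortices are pairwise distinct and, for some centre of
rotation `c`, `-lam (x i - c) = ∑_{j ≠ i} Γ j / ‖x i - x j‖² (x j - x i)` for every `i`. -/
def IsRelativeEquilibrium {n : ℕ} (Γ : Fin n → ℝ) (x : Fin n → Plane) (lam : ℝ) : Prop :=
  Function.Injective x ∧ lam ≠ 0 ∧ ∃ c : Plane, ∀ i : Fin n,
    -(lam • (x i - c)) =
      ∑ j ∈ Finset.univ.erase i, (Γ j / dist (x i) (x j) ^ 2) • (x j - x i)

/-- A configuration is strictly planar if its points do not all lie on one line. -/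
def IsStrictlyPlanar {n : ℕ} (x : Fin n → Plane) : Prop :=
  ¬ Collinear ℝ (Set.range x)

/-- A configuration has a line of symmetry if the orthogonal reflection of the plane in some line
`q + L` maps the set of its points onto itself. -/
def HasLineOfSymmetry {n : ℕ} (x : Fin n → Plane) : Prop :=
  ∃ (q : Plane) (L : Submodule ℝ Plane), Module.finrank ℝ L = 1 ∧
    (fun y : Plane => q + L.reflection (y - q)) '' Set.range x = Set.range x

/-- The strengths `Γ₁ = Γ₂ = 1`, `Γ₃ = Γ₄ = m`. -/
def vortexStrengths (m : ℝ) : Fin 4 → ℝ := ![1, 1, m, m]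

/-- The point `(s₁₂, s₁₃, s₁₄, s₂₃, s₂₄, s₃₄, m)` of `ℝ⁷`, where `sᵢⱼ` is the squared distance
between the vortices `i` and `j`. -/
def squaredDistancesAndStrength (x : Fin 4 → Plane) (m : ℝ) : Fin 7 → ℝ :=
  ![dist (x 0) (x 1) ^ 2, dist (x 0) (x 2) ^ 2, dist (x 0) (x 3) ^ 2,
    dist (x 1) (x 2) ^ 2, dist (x 1) (x 3) ^ 2, dist (x 2) (x 3) ^ 2, m]

/-- The set, in `(sᵢⱼ, m)`-space, of the strictly planar relative equilibria without a line of
symmetry of four vortices of strengths `1, 1, m, m`, where `m ∈ (-1, 1]`, `m ≠ 0`, normalized by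
`-lam / (Γ₁ + Γ₂ + Γ₃ + Γ₄) = -1`. -/
def asymmetricRelativeEquilibria : Set (Fin 7 → ℝ) :=
  {p | ∃ (m lam : ℝ) (x : Fin 4 → Plane),
    -1 < m ∧ m ≤ 1 ∧ m ≠ 0 ∧
    IsRelativeEquilibrium (vortexStrengths m) x lam ∧
    -lam / (∑ i, vortexStrengths m i) = -1 ∧
    IsStrictlyPlanar x ∧ ¬ HasLineOfSymmetry x ∧
    p = squaredDistancesAndStrength x m}

/-- The variety of a set of points of `ℝⁿ`: the smallest real affine algebraic variety containing
it. -/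
def varietyOf {n : ℕ} (S : Set (Fin n → ℝ)) : Set (Fin n → ℝ) :=
  MvPolynomial.zeroLocus ℝ (MvPolynomial.vanishingIdeal ℝ S)

/-- The dimension of the real affine variety `V`: the Krull dimension of its coordinate ring
`ℝ[x₁, …, xₙ] / I(V)`. -/
def varietyDim {n : ℕ} (V : Set (Fin n → ℝ)) : WithBot ℕ∞ :=
  ringKrullDim (MvPolynomial (Fin n) ℝ ⧸ MvPolynomial.vanishingIdeal ℝ V)

/-- The Zariski tangent space of `V` at `p`, translated to the origin: the common zeros of the
linear forms `v ↦ ∑ᵢ ∂f/∂xᵢ(p) vᵢ`, for `f` in the ideal `I(V)` of all polynomials that vanish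
on `V`. -/
def zariskiTangentSpace {n : ℕ} (V : Set (Fin n → ℝ)) (p : Fin n → ℝ) :
    Submodule ℝ (Fin n → ℝ) where
  carrier := {v | ∀ f ∈ MvPolynomial.vanishingIdeal ℝ V,
    ∑ i, MvPolynomial.eval p (MvPolynomial.pderiv i f) * v i = 0}
  zero_mem' := by
    intro f _
    simp
  add_mem' := by
    intro a b ha hb f hf
    simp only [Pi.add_apply, mul_add, Finset.sum_add_distrib, ha f hf, hb f hf, add_zero]
  smul_mem' := by
    intro c a ha f hf
    simp only [Pi.smul_apply, smul_eq_mul, mul_left_comm _ c, ← Finset.mul_sum, ha f hf, mul_zero]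

/-- `p` is a singular point of the variety `V`: it lies on `V` and the dimension of the Zariski
tangent space at `p` is not the dimension of `V`. -/
def IsSingularPoint {n : ℕ} (V : Set (Fin n → ℝ)) (p : Fin n → ℝ) : Prop :=
  p ∈ V ∧ (Module.finrank ℝ (zariskiTangentSpace V p) : WithBot ℕ∞) ≠ varietyDim V

/-- `M` is a `d`-dimensional `C^∞` (embedded) submanifold of `ℝⁿ`: around each of its points there
is a `C^∞` diffeomorphism between open subsets of `ℝⁿ` that takes `M` to the vanishing of all the
coordinates but the first `d`. -/
def IsSmoothSubmanifold {n : ℕ} (d : ℕ) (M : Set (Fin n → ℝ)) : Prop :=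
  ∀ p ∈ M, ∃ Φ : OpenPartialHomeomorph (Fin n → ℝ) (Fin n → ℝ),
    p ∈ Φ.source ∧ ContDiffOn ℝ ∞ Φ Φ.source ∧ ContDiffOn ℝ ∞ Φ.symm Φ.target ∧
    ∀ y ∈ Φ.source, (y ∈ M ↔ ∀ i : Fin n, d ≤ (i : ℕ) → Φ y i = 0)

end

/-! Number the vortices from 1. The normalization makes the angular velocity equal to the total
strength, so the centre drops out and the equations read `∑ j, Γ j * S i j * (x j - x i) = 0` with
`S i j = 1 / s i j - 1`. Crossing them with edge vectors gives Dziobek's factorization: `Γ i * Γ j *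
S i j` is proportional to `A i * A j`, where the `A i` are signed areas, the coefficients of the
affine dependence of the four points (`shape_factorization`). Also `∑ j, A j * s i j` does not
depend on `i`. Asymmetry makes `A₁ + A₂`, `A₁ - A₂` and `A₃ - A₄` nonzero, so the areas scale to `1
+ l, 1 - l, -(1 + g), -(1 - g)` with `l, g ≠ 0`. Elimination (`shape_relations_of_scaled_areas`)
then leaves `(1 + m)(1 + g²) = 2` and the hyperbola `l² = 4 + g²`, parametrized by `l = t + t⁻¹`, `g
= t - t⁻¹`. Conversely, every `t ≠ 0` with `g ≠ 0` and `m ≠ 0` is realized by points of the plane.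
So `E` is the image of a cofinite set of parameters (`asymmetricRelativeEquilibria_eq`).

The rest holds because `t = s₂₃ - s₁₄` and `t⁻¹ = s₂₄ - s₁₃` are linear in the coordinates. The
curve over `t ≠ 0` is a graph, hence a submanifold. It is cut out by six polynomials and `E` is
dense in it, so it is `V`. Its coordinate ring consists of fractions of `ℝ[t]` and is a principal
ideal domain, so the dimension is one; the differentials of the six relations leave a line as
tangent space. -/

/-! ### The curve and its straightening -/

/-- The curve of the squared mutual distances and the strength, parametrized by `s₂₃ - s₁₄`. -/
noncomputable def vortexCurve (t : ℝ) : Fin 7 → ℝ :=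
  ![(1 + (t - t⁻¹) ^ 2) / 2, (t + t⁻¹ - 1) * t⁻¹ / 2, (t + t⁻¹ - 1) * t / 2,
    (t + t⁻¹ + 1) * t / 2, (t + t⁻¹ + 1) * t⁻¹ / 2, (3 + (t - t⁻¹) ^ 2) / 2,
    2 / (1 + (t - t⁻¹) ^ 2) - 1]

theorem vortexCurve_param (t : ℝ) : vortexCurve t 3 - vortexCurve t 2 = t := by
  simp [vortexCurve]; ring

theorem contDiffOn_vortexCurve : ContDiffOn ℝ ∞ vortexCurve {0}ᶜ := by
  have hinv : ContDiffOn ℝ ∞ (fun t : ℝ => t⁻¹) {0}ᶜ := contDiffOn_inv ℝ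
  have hid : ContDiffOn ℝ ∞ (fun t : ℝ => t) {0}ᶜ := contDiffOn_id
  have hg := ((hid.sub hinv).pow 2)
  have hne : ∀ t ∈ ({0}ᶜ : Set ℝ), 1 + (t - t⁻¹) ^ 2 ≠ 0 := fun t _ => by positivity
  rw [contDiffOn_pi]
  intro i
  fin_cases i <;> simp [vortexCurve]
  · exact (contDiffOn_const.add hg).div_const 2
  · exact (((hid.add hinv).sub contDiffOn_const).mul hinv).div_const 2
  · exact (((hid.add hinv).sub contDiffOn_const).mul hid).div_const 2
  · exact (((hid.add hinv).add contDiffOn_const).mul hid).div_const 2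
  · exact (((hid.add hinv).add contDiffOn_const).mul hinv).div_const 2
  · exact (contDiffOn_const.add hg).div_const 2
  · exact (contDiffOn_const.div (contDiffOn_const.add hg) hne).sub contDiffOn_const

/-- The global straightening: `y ↦ (T, y - vortexCurve T)` with `T = y₃ - y₂`. -/
noncomputable def straightening (W : Set ℝ) (hW : IsOpen W) (hW0 : W ⊆ {0}ᶜ) :
    OpenPartialHomeomorph (Fin 7 → ℝ) (Fin 7 → ℝ) where
  -- No residual is kept for `y 3`: since `y 3 = y 2 + T`, it would repeat that of `y 2`.
  toFun y := ![y 3 - y 2, y 0 - vortexCurve (y 3 - y 2) 0, y 1 - vortexCurve (y 3 - y 2) 1,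
    y 2 - vortexCurve (y 3 - y 2) 2, y 4 - vortexCurve (y 3 - y 2) 4,
    y 5 - vortexCurve (y 3 - y 2) 5, y 6 - vortexCurve (y 3 - y 2) 6]
  invFun z := ![z 1 + vortexCurve (z 0) 0, z 2 + vortexCurve (z 0) 1, z 3 + vortexCurve (z 0) 2,
    z 3 + vortexCurve (z 0) 3, z 4 + vortexCurve (z 0) 4, z 5 + vortexCurve (z 0) 5,
    z 6 + vortexCurve (z 0) 6]
  source := {y | y 3 - y 2 ∈ W}
  target := {z | z 0 ∈ W}
  map_source' y hy := by simpa using hy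
  map_target' z hz := by simpa [vortexCurve_param] using hz
  left_inv' y hy := by
    have := vortexCurve_param (y 3 - y 2)
    ext i
    fin_cases i <;> simp
    linarith
  right_inv' z hz := by
    have := vortexCurve_param (z 0)
    ext i
    fin_cases i <;> simp [this]
  open_source := hW.preimage (by fun_prop)
  open_target := hW.preimage (by fun_prop)
  continuousOn_toFun := by
    have h : ContinuousOn (fun y : Fin 7 → ℝ => vortexCurve (y 3 - y 2)) {y | y 3 - y 2 ∈ W} :=
      contDiffOn_vortexCurve.continuousOn.comp (by fun_prop) fun y hy => hW0 hy
    have h' := fun i => (continuousOn_pi.1 h) i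
    refine continuousOn_pi.2 fun i => ?_
    fin_cases i <;> simp
    · fun_prop
    all_goals exact ContinuousOn.sub (by fun_prop) (h' _)
  continuousOn_invFun := by
    have h : ContinuousOn (fun y : Fin 7 → ℝ => vortexCurve (y 0)) {y | y 0 ∈ W} :=
      contDiffOn_vortexCurve.continuousOn.comp (by fun_prop) fun y hy => hW0 hy
    have h' := fun i => (continuousOn_pi.1 h) i
    refine continuousOn_pi.2 fun i => ?_
    fin_cases i <;> simp
    all_goals exact ContinuousOn.add (by fun_prop) (h' _)

theorem isSmoothSubmanifold_vortexCurve_image {W : Set ℝ} (hW : IsOpen W) (hW0 : W ⊆ {0}ᶜ) :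
    IsSmoothSubmanifold 1 (vortexCurve '' W) := by
  rintro _ ⟨t, ht, rfl⟩
  refine ⟨straightening W hW hW0, ?_, ?_, ?_, ?_⟩
  · change vortexCurve t 3 - vortexCurve t 2 ∈ W
    rwa [vortexCurve_param]
  · have h : ContDiffOn ℝ ∞ (fun y : Fin 7 → ℝ => vortexCurve (y 3 - y 2)) {y | y 3 - y 2 ∈ W} :=
      contDiffOn_vortexCurve.comp (by fun_prop) fun y hy => hW0 hy
    have h' := fun i => (contDiffOn_pi.1 h) i
    refine contDiffOn_pi.2 fun i => ?_
    fin_cases i <;> simp [straightening]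
    · fun_prop
    all_goals exact ContDiffOn.sub (by fun_prop) (h' _)
  · have h : ContDiffOn ℝ ∞ (fun y : Fin 7 → ℝ => vortexCurve (y 0)) {y | y 0 ∈ W} :=
      contDiffOn_vortexCurve.comp (by fun_prop) fun y hy => hW0 hy
    have h' := fun i => (contDiffOn_pi.1 h) i
    refine contDiffOn_pi.2 fun i => ?_
    fin_cases i <;> simp [straightening]
    all_goals exact ContDiffOn.add (by fun_prop) (h' _)
  · intro y hy
    constructor
    · rintro ⟨s, hs, rfl⟩ i hi
      fin_cases i <;> simp [straightening, vortexCurve_param] at hi ⊢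
    · intro h
      refine ⟨y 3 - y 2, hy, ?_⟩
      have h1 := h 1 (by decide)
      have h2 := h 2 (by decide)
      have h3 := h 3 (by decide)
      have h4 := h 4 (by decide)
      have h5 := h 5 (by decide)
      have h6 := h 6 (by decide)
      simp [straightening] at h1 h2 h3 h4 h5 h6
      have := vortexCurve_param (y 3 - y 2)
      ext i
      fin_cases i <;> simp <;> linarith

/-! ### Polynomial equations and Zariski closure -/

open MvPolynomial in
/-- Equations of the closure of the curve: with `T = x₃ - x₂` and `T' = x₄ - x₁` they say
`T T' = 1` and express the other coordinates by `T` and `T'`. -/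
noncomputable def curveRelations : Fin 6 → MvPolynomial (Fin 7) ℝ :=
  ![(X 3 - X 2) * (X 4 - X 1) - 1,
    2 * X 0 - (1 + ((X 3 - X 2) - (X 4 - X 1)) ^ 2),
    2 * X 1 - ((X 3 - X 2) + (X 4 - X 1) - 1) * (X 4 - X 1),
    2 * X 2 - ((X 3 - X 2) + (X 4 - X 1) - 1) * (X 3 - X 2),
    2 * X 5 - (3 + ((X 3 - X 2) - (X 4 - X 1)) ^ 2),
    X 0 * (X 6 + 1) - 1]

theorem vortexCurve_param_inv (t : ℝ) : vortexCurve t 4 - vortexCurve t 1 = t⁻¹ := by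
  simp [vortexCurve]; ring

theorem eval_curveRelations_vortexCurve {t : ℝ} (ht : t ≠ 0) (k : Fin 6) :
    MvPolynomial.eval (vortexCurve t) (curveRelations k) = 0 := by
  have h3 := vortexCurve_param t
  have h4 := vortexCurve_param_inv t
  have hg : 1 + (t - t⁻¹) ^ 2 ≠ 0 := by positivity
  fin_cases k <;> simp [curveRelations, h3, h4] <;> simp [vortexCurve, ht] <;> field_simp <;> ring

theorem eq_vortexCurve_of_eval_curveRelations {y : Fin 7 → ℝ}
    (h : ∀ k, MvPolynomial.eval y (curveRelations k) = 0) :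
    y 3 - y 2 ≠ 0 ∧ vortexCurve (y 3 - y 2) = y := by
  have h0 := h 0
  have h1 := h 1
  have h2 := h 2
  have h3 := h 3
  have h4 := h 4
  have h5 := h 5
  simp [curveRelations] at h0 h1 h2 h3 h4 h5
  obtain ⟨t, ht⟩ : ∃ t, t = y 3 - y 2 := ⟨_, rfl⟩
  rw [← ht] at h0 h1 h2 h3 h4 ⊢
  have ht0 : t ≠ 0 := by
    rintro rfl
    simp at h0
  have hinv : y 4 - y 1 = t⁻¹ := by
    apply eq_inv_of_mul_eq_one_right
    linarith
  rw [hinv] at h1 h2 h3 h4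
  have hg : 1 + (t - t⁻¹) ^ 2 ≠ 0 := by positivity
  refine ⟨ht0, ?_⟩
  ext i
  fin_cases i <;> simp [vortexCurve]
  · linarith
  · linarith
  · linarith
  · linarith
  · linarith
  · linarith
  · rw [sub_eq_iff_eq_add, div_eq_iff hg]
    linear_combination (y 6 + 1) * h1 - 2 * h5

theorem curveRelations_mem_vanishingIdeal {W : Set ℝ} (hW0 : W ⊆ {0}ᶜ) (k : Fin 6) :
    curveRelations k ∈ MvPolynomial.vanishingIdeal ℝ (vortexCurve '' W) := by
  rintro _ ⟨t, ht, rfl⟩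
  rw [MvPolynomial.aeval_eq_eval]
  exact eval_curveRelations_vortexCurve (hW0 ht) k

/-- The six relations bound the variety from above. For the other inclusion, a polynomial vanishing
on the image of `W` vanishes on its closure by continuity, hence at every `t ≠ 0`. -/
theorem varietyOf_vortexCurve_image {W : Set ℝ} (hW0 : W ⊆ {0}ᶜ) (hW : {0}ᶜ ⊆ closure W) :
    varietyOf (vortexCurve '' W) = vortexCurve '' {0}ᶜ := by
  apply Set.Subset.antisymm
  · intro y hy
    have := eq_vortexCurve_of_eval_curveRelations (y := y) fun k => by
      have := hy _ (curveRelations_mem_vanishingIdeal hW0 k)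
      rwa [MvPolynomial.aeval_eq_eval] at this
    exact ⟨_, this.1, this.2⟩
  · rintro _ ⟨t, ht, rfl⟩ f hf
    have hc : ContinuousAt vortexCurve t :=
      contDiffOn_vortexCurve.continuousOn.continuousAt (isOpen_compl_singleton.mem_nhds ht)
    have h1 : vortexCurve t ∈ closure (vortexCurve '' W) :=
      hc.continuousWithinAt.mem_closure_image (hW ht)
    have h2 : IsClosed {y : Fin 7 → ℝ | MvPolynomial.aeval y f = 0} := by
      simp only [MvPolynomial.aeval_eq_eval]
      exact isClosed_eq (MvPolynomial.continuous_eval f) continuous_const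
    exact closure_minimal (fun y hy => hf y hy) h2 h1

/-! ### Tangent spaces -/

theorem MvPolynomial.hasDerivAt_eval_comp {σ : Type*} [Fintype σ] (f : MvPolynomial σ ℝ)
    {γ : ℝ → σ → ℝ} {γ' : σ → ℝ} {t : ℝ} (hγ : HasDerivAt γ γ' t) :
    HasDerivAt (fun s => MvPolynomial.eval (γ s) f)
      (∑ i, MvPolynomial.eval (γ t) (MvPolynomial.pderiv i f) * γ' i) t := by
  classical
  have hγi := hasDerivAt_pi.1 hγ
  induction f using MvPolynomial.induction_on with
  | C a => simpa using hasDerivAt_const t a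
  | add p q hp hq =>
    simp only [map_add, add_mul, Finset.sum_add_distrib]
    exact hp.add hq
  | mul_X p j hp =>
    have := hp.mul (hγi j)
    simp only [map_mul, MvPolynomial.eval_X]
    refine this.congr_deriv ?_
    simp only [Derivation.leibniz, MvPolynomial.pderiv_X, smul_eq_mul, map_add, map_mul,
      MvPolynomial.eval_X, add_mul, Finset.sum_add_distrib, Finset.sum_mul]
    rw [add_comm]
    congr 1
    · rw [Finset.sum_eq_single j] <;> simp +contextual [eq_comm]
    · exact Finset.sum_congr rfl fun i _ => by ring

theorem deriv_mem_zariskiTangentSpace {V : Set (Fin 7 → ℝ)} {γ : ℝ → Fin 7 → ℝ} {γ' : Fin 7 → ℝ}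
    {t : ℝ} (hγ : HasDerivAt γ γ' t) (hV : ∀ᶠ s in nhds t, γ s ∈ V) :
    γ' ∈ zariskiTangentSpace V (γ t) := by
  intro f hf
  have h1 := f.hasDerivAt_eval_comp hγ
  have h2 : (fun s => MvPolynomial.eval (γ s) f) =ᶠ[nhds t] fun _ => 0 := by
    filter_upwards [hV] with s hs
    have := hf _ hs
    rwa [MvPolynomial.aeval_eq_eval] at this
  exact h1.unique ((hasDerivAt_const t (0 : ℝ)).congr_of_eventuallyEq h2)

/-- This is injectivity of `v ↦ v 3 - v 2` on the tangent space. The differential of `T T' = 1`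
carries the vanishing over to `v 4 - v 1`, and each other relation then determines one more
coordinate. -/
theorem eq_zero_of_mem_zariskiTangentSpace {t : ℝ} (ht : t ≠ 0) {v : Fin 7 → ℝ}
    (hv : v ∈ zariskiTangentSpace (vortexCurve '' {0}ᶜ) (vortexCurve t)) (hv0 : v 3 - v 2 = 0) :
    v = 0 := by
  have h := fun k => hv _ (curveRelations_mem_vanishingIdeal subset_rfl k)
  have h0 := h 0
  have h1 := h 1
  have h2 := h 2
  have h3 := h 3
  have h4 := h 4
  have h5 := h 5
  have e3 := vortexCurve_param t
  have e4 := vortexCurve_param_inv t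
  have p2 : ∀ i : Fin 7, MvPolynomial.pderiv i (2 : MvPolynomial (Fin 7) ℝ) = 0 := fun i =>
    (MvPolynomial.pderiv i).map_natCast 2
  have p3 : ∀ i : Fin 7, MvPolynomial.pderiv i (3 : MvPolynomial (Fin 7) ℝ) = 0 := fun i =>
    (MvPolynomial.pderiv i).map_natCast 3
  simp [curveRelations, Fin.sum_univ_succ, MvPolynomial.pderiv_X, Pi.single_apply, e3, e4, p2, p3]
    at h0 h1 h2 h3 h4 h5
  have hv1 : v 4 - v 1 = 0 := by
    have : t * (v 4 - v 1) = 0 := by linear_combination h0 - t⁻¹ * hv0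
    exact (mul_eq_zero.1 this).resolve_left ht
  have z0 : v 0 = 0 := by linear_combination h1 / 2 + (t - t⁻¹) * (hv0 - hv1)
  have z1 : v 1 = 0 := by
    linear_combination h2 / 2 + t⁻¹ / 2 * hv0 + (t + 2 * t⁻¹ - 1) / 2 * hv1
  have z2 : v 2 = 0 := by
    linear_combination h3 / 2 + t / 2 * hv1 + (2 * t + t⁻¹ - 1) / 2 * hv0
  have z5 : v 5 = 0 := by linear_combination h4 / 2 + (t - t⁻¹) * (hv0 - hv1)
  have z6 : v 6 = 0 := by
    have h0ne : vortexCurve t 0 ≠ 0 := by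
      simp only [vortexCurve, Matrix.cons_val_zero]
      positivity
    have : vortexCurve t 0 * v 6 = 0 := by linear_combination h5 - (vortexCurve t 6 + 1) * z0
    exact (mul_eq_zero.1 this).resolve_left h0ne
  ext i
  fin_cases i <;> simp
  · exact z0
  · exact z1
  · exact z2
  · linarith
  · linarith
  · exact z5
  · exact z6

theorem finrank_zariskiTangentSpace_vortexCurve {t : ℝ} (ht : t ≠ 0) :
    Module.finrank ℝ (zariskiTangentSpace (vortexCurve '' {0}ᶜ) (vortexCurve t)) = 1 := by
  have hd : DifferentiableAt ℝ vortexCurve t :=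
    (contDiffOn_vortexCurve.contDiffAt (isOpen_compl_singleton.mem_nhds ht)).differentiableAt
      (by simp)
  obtain ⟨w, hw⟩ : ∃ w, w = deriv vortexCurve t := ⟨_, rfl⟩
  have hder : HasDerivAt vortexCurve w t := hw ▸ hd.hasDerivAt
  have hmem : w ∈ zariskiTangentSpace (vortexCurve '' {0}ᶜ) (vortexCurve t) :=
    deriv_mem_zariskiTangentSpace hder <| by
      filter_upwards [isOpen_compl_singleton.mem_nhds ht] with s hs using ⟨s, hs, rfl⟩
  -- The functional `v 3 - v 2` is the differential of the parameter itself, so it takes the value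
  -- one on the velocity; with injectivity this makes the velocity a basis.
  have hw1 : w 3 - w 2 = 1 := by
    have h1 := (hasDerivAt_pi.1 hder 3).sub (hasDerivAt_pi.1 hder 2)
    have h2 : (fun s => vortexCurve s 3) - (fun s => vortexCurve s 2) = id :=
      funext vortexCurve_param
    rw [h2] at h1
    exact h1.unique (hasDerivAt_id t)
  rw [finrank_eq_one_iff']
  refine ⟨⟨w, hmem⟩, ?_, ?_⟩
  · intro h
    have : w = 0 := congrArg Subtype.val h
    simp [this] at hw1
  · rintro ⟨v, hv⟩
    refine ⟨v 3 - v 2, Subtype.ext ?_⟩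
    have := eq_zero_of_mem_zariskiTangentSpace ht
      (Submodule.sub_mem _ hv (Submodule.smul_mem _ (v 3 - v 2) hmem)) (by
        simp only [Pi.sub_apply, Pi.smul_apply, smul_eq_mul]
        linear_combination -(v 3 - v 2) * hw1)
    exact (sub_eq_zero.1 this).symm

/-! ### Krull dimension of the coordinate ring -/

/-- `R` behaves like the localization `P[1/h]`: each element is the image of one of `P` up to a
unit. So an ideal is generated by the image of a generator of its contraction, and `R` is a
principal ideal domain. -/
theorem ringKrullDim_eq_one_of_fractions {P R : Type*} [CommRing P] [IsDomain P]
    [IsPrincipalIdealRing P] [CommRing R] (i : P →+* R) (hi : Function.Injective i)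
    (h : P) (hu : IsUnit (i h)) (hs : ∀ r, ∃ (n : ℕ) (a : P), r * i h ^ n = i a)
    (hR : ¬ IsField R) : ringKrullDim R = 1 := by
  have hdom : IsDomain R := by
    have : Nontrivial R := hi.nontrivial
    have : NoZeroDivisors R := ⟨fun {r s} hrs => by
      obtain ⟨n, a, ha⟩ := hs r
      obtain ⟨k, b, hb⟩ := hs s
      have hab : a * b = 0 := hi <| by
        rw [map_mul, ← ha, ← hb, map_zero]
        linear_combination i h ^ n * i h ^ k * hrs
      rcases mul_eq_zero.1 hab with rfl | rfl
      · left
        rw [map_zero] at ha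
        exact (hu.pow n).mul_left_eq_zero.1 ha
      · right
        rw [map_zero] at hb
        exact (hu.pow k).mul_left_eq_zero.1 hb⟩
    exact NoZeroDivisors.to_isDomain R
  have hpid : IsPrincipalIdealRing R := ⟨fun J => by
    obtain ⟨b, hb⟩ := IsPrincipalIdealRing.principal (J.comap i)
    refine ⟨i b, le_antisymm (fun r hr => ?_) ?_⟩
    · obtain ⟨n, a, ha⟩ := hs r
      have : a ∈ J.comap i := by
        rw [Ideal.mem_comap, ← ha]
        exact J.mul_mem_right _ hr
      rw [hb] at this
      obtain ⟨c, rfl⟩ := Ideal.mem_span_singleton'.1 this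
      rw [Ideal.submodule_span_eq]
      rw [← Ideal.mul_unit_mem_iff_mem _ (hu.pow n), ha, map_mul]
      exact Ideal.mul_mem_left _ _ (Ideal.mem_span_singleton_self _)
    · rw [Ideal.submodule_span_eq, Ideal.span_singleton_le_iff_mem]
      have : b ∈ J.comap i := by
        rw [hb]
        exact Ideal.mem_span_singleton_self b
      exact this⟩
  exact IsPrincipalIdealRing.ringKrullDim_eq_one R hR

/-- The fractions `a / h ^ n` over the image of an algebra homomorphism. -/
def fractionSubalgebra {P R : Type*} [CommRing P] [CommRing R] [Algebra ℝ P] [Algebra ℝ R]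
    (i : P →ₐ[ℝ] R) (h : P) : Subalgebra ℝ R where
  carrier := {r | ∃ (n : ℕ) (a : P), r * i h ^ n = i a}
  mul_mem' := by
    rintro r s ⟨n, a, ha⟩ ⟨k, b, hb⟩
    refine ⟨n + k, a * b, ?_⟩
    rw [map_mul, ← ha, ← hb]
    ring
  add_mem' := by
    rintro r s ⟨n, a, ha⟩ ⟨k, b, hb⟩
    refine ⟨n + k, a * h ^ k + b * h ^ n, ?_⟩
    rw [map_add, map_mul, map_mul, map_pow, map_pow, ← ha, ← hb]
    ring
  algebraMap_mem' c := ⟨0, algebraMap ℝ P c, by simp⟩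

theorem varietyDim_vortexCurve : varietyDim (vortexCurve '' {0}ᶜ) = 1 := by
  unfold varietyDim
  obtain ⟨I, hI⟩ : ∃ I, I = MvPolynomial.vanishingIdeal ℝ (vortexCurve '' {0}ᶜ) := ⟨_, rfl⟩
  rw [← hI]
  obtain ⟨x, hx⟩ : ∃ x : Fin 7 → MvPolynomial (Fin 7) ℝ ⧸ I,
    x = fun j => Ideal.Quotient.mk I (MvPolynomial.X j) := ⟨_, rfl⟩
  have hrel : ∀ k, Ideal.Quotient.mk I (curveRelations k) = 0 := fun k => by
    rw [Ideal.Quotient.eq_zero_iff_mem, hI]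
    exact curveRelations_mem_vanishingIdeal subset_rfl k
  have h0 := hrel 0
  have h1 := hrel 1
  have h2 := hrel 2
  have h3 := hrel 3
  have h4 := hrel 4
  have h5 := hrel 5
  have hxj : ∀ j, Ideal.Quotient.mk I (MvPolynomial.X j) = x j := fun j => by rw [hx]
  simp only [curveRelations, Fin.isValue, Matrix.cons_val, map_sub, map_mul, map_add, map_pow,
    map_one, map_ofNat, hxj] at h0 h1 h2 h3 h4 h5
  obtain ⟨T, hT⟩ : ∃ T, T = x 3 - x 2 := ⟨_, rfl⟩
  obtain ⟨T', hT'⟩ : ∃ T', T' = x 4 - x 1 := ⟨_, rfl⟩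
  rw [← hT, ← hT'] at h0 h1 h2 h3 h4
  obtain ⟨i, hi⟩ : ∃ i, i = Polynomial.aeval (R := ℝ) T := ⟨_, rfl⟩
  -- The factor `X` makes `T' = T⁻¹` a fraction. The quartic equals `2 T² x₀` at `T`, which makes `x
  -- 6 + 1 = x₀⁻¹` a fraction.
  obtain ⟨h, hh⟩ : ∃ h : Polynomial ℝ, h = Polynomial.X * (Polynomial.X ^ 4 - Polynomial.X ^ 2 + 1) :=
    ⟨_, rfl⟩
  have hih : i h = T * (T ^ 4 - T ^ 2 + 1) := by simp [hi, hh]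
  have hev : ∀ t : ℝ, t ≠ 0 → ∃ e : (MvPolynomial (Fin 7) ℝ ⧸ I) →+* ℝ,
      ∀ a, e (i a) = a.eval t := fun t ht => by
    refine ⟨Ideal.Quotient.lift I (MvPolynomial.eval (vortexCurve t)) fun f hf => ?_, fun a => ?_⟩
    · rw [hI] at hf
      have := hf _ ⟨t, ht, rfl⟩
      rwa [MvPolynomial.aeval_eq_eval] at this
    · induction a using Polynomial.induction_on' with
      | add p q hp hq => simp only [map_add, hp, hq, Polynomial.eval_add]
      | monomial n c =>
        have : i (Polynomial.monomial n c) =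
            Ideal.Quotient.mk I (MvPolynomial.C c * (MvPolynomial.X 3 - MvPolynomial.X 2) ^ n) := by
          rw [hi, Polynomial.aeval_monomial, hT, hx]
          simp
          rfl
        rw [this, Ideal.Quotient.lift_mk]
        simp [vortexCurve_param]
  obtain ⟨κ, hκ⟩ : ∃ κ, κ = algebraMap ℝ (MvPolynomial (Fin 7) ℝ ⧸ I) 2⁻¹ := ⟨_, rfl⟩
  have hκ2 : 2 * κ = 1 := by
    rw [hκ, ← map_ofNat (algebraMap ℝ (MvPolynomial (Fin 7) ℝ ⧸ I)) 2, ← map_mul]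
    simp
  have hz : T * T' = 1 := by linear_combination h0
  have e1 : T ^ 4 - T ^ 2 + 1 = 2 * T ^ 2 * x 0 := by
    linear_combination -T ^ 2 * h1 + (2 * T ^ 2 - (T * T' + 1)) * h0
  have e2 : x 0 * (x 6 + 1) = 1 := by linear_combination h5
  have hu : IsUnit (i h) := by
    rw [hih, e1]
    refine IsUnit.of_mul_eq_one (T' ^ 3 * (x 6 + 1) * κ) ?_
    calc T * (2 * T ^ 2 * x 0) * (T' ^ 3 * (x 6 + 1) * κ)
        = (T * T') ^ 3 * (x 0 * (x 6 + 1)) * (2 * κ) := by ring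
      _ = 1 := by rw [hz, e2, hκ2]; ring
  -- A polynomial in the kernel vanishes at every `t ≠ 0`, by evaluation at points of the curve.
  have hinj : Function.Injective i := by
    rw [injective_iff_map_eq_zero]
    intro a ha
    refine Polynomial.eq_zero_of_infinite_isRoot a
      ((Set.finite_singleton (0 : ℝ)).infinite_compl.mono fun t ht => ?_)
    obtain ⟨e, he⟩ := hev t ht
    change a.eval t = 0
    rw [← he, ha, map_zero]
  apply ringKrullDim_eq_one_of_fractions i.toRingHom hinj h hu ?_ ?_
  -- The fractions form a subalgebra, so only the classes of the seven coordinates need checking.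
  · obtain ⟨S, hS⟩ : ∃ S, S = fractionSubalgebra i h := ⟨_, rfl⟩
    have mT : T ∈ S := by
      rw [hS]
      exact ⟨0, Polynomial.X, by simp [hi]⟩
    have mT' : T' ∈ S := by
      rw [hS]
      refine ⟨1, Polynomial.X ^ 4 - Polynomial.X ^ 2 + 1, ?_⟩
      rw [pow_one, hih]
      simp only [hi, map_add, map_sub, map_pow, map_one, Polynomial.aeval_X]
      linear_combination (T ^ 4 - T ^ 2 + 1) * hz
    have mκ : κ ∈ S := hκ ▸ S.algebraMap_mem _
    have m1 : (1 : MvPolynomial (Fin 7) ℝ ⧸ I) ∈ S := S.one_mem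
    have m3 : (3 : MvPolynomial (Fin 7) ℝ ⧸ I) ∈ S := S.natCast_mem 3
    have mg := S.pow_mem (S.sub_mem mT mT') 2
    have ml := S.sub_mem (S.add_mem mT mT') m1
    have mw : x 6 + 1 ∈ S := by
      rw [hS]
      refine ⟨1, 2 * Polynomial.X ^ 3, ?_⟩
      rw [pow_one, hih, e1]
      simp only [hi, map_mul, map_pow, map_ofNat, Polynomial.aeval_X]
      linear_combination 2 * T ^ 3 * e2
    have mx0 : x 0 ∈ S := by
      have : x 0 = κ * (1 + (T - T') ^ 2) := by linear_combination κ * h1 - x 0 * hκ2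
      exact this ▸ S.mul_mem mκ (S.add_mem m1 mg)
    have mx1 : x 1 ∈ S := by
      have : x 1 = κ * ((T + T' - 1) * T') := by linear_combination κ * h2 - x 1 * hκ2
      exact this ▸ S.mul_mem mκ (S.mul_mem ml mT')
    have mx2 : x 2 ∈ S := by
      have : x 2 = κ * ((T + T' - 1) * T) := by linear_combination κ * h3 - x 2 * hκ2
      exact this ▸ S.mul_mem mκ (S.mul_mem ml mT)
    have mx3 : x 3 ∈ S := by
      have : x 3 = x 2 + T := by linear_combination -hT
      exact this ▸ S.add_mem mx2 mT
    have mx4 : x 4 ∈ S := by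
      have : x 4 = x 1 + T' := by linear_combination -hT'
      exact this ▸ S.add_mem mx1 mT'
    have mx5 : x 5 ∈ S := by
      have : x 5 = κ * (3 + (T - T') ^ 2) := by linear_combination κ * h4 - x 5 * hκ2
      exact this ▸ S.mul_mem mκ (S.add_mem m3 mg)
    have mx6 : x 6 ∈ S := by
      have : x 6 = (x 6 + 1) - 1 := by ring
      exact this ▸ S.sub_mem mw m1
    have mx : ∀ j, x j ∈ S := fun j => by fin_cases j <;> assumption
    intro r
    have hr : r ∈ S := by
      obtain ⟨f, rfl⟩ := Ideal.Quotient.mk_surjective r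
      induction f using MvPolynomial.induction_on with
      | C c => exact S.algebraMap_mem c
      | add p q hp hq =>
        rw [map_add]
        exact S.add_mem hp hq
      | mul_X p j hp =>
        rw [map_mul, hxj]
        exact S.mul_mem hp (mx j)
    rw [hS] at hr
    exact hr
  · intro hf
    -- `T - 2` is nonzero but vanishes at the point `t = 2` of the curve, so it is not invertible.
    have hne : i (Polynomial.X - Polynomial.C 2) ≠ 0 := by
      rw [Ne, map_eq_zero_iff i hinj]
      exact Polynomial.X_sub_C_ne_zero 2
    obtain ⟨r, hr⟩ := hf.mul_inv_cancel hne
    obtain ⟨e, he⟩ := hev 2 two_ne_zero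
    have := congrArg e hr
    rw [map_mul, he] at this
    simp at this

/-! ### Elimination for the scaled areas -/

/-- After division by `l` and `g`, the first two area equations express `N * s12` and `N * s34`
through two symmetric quantities `X`, `Y`, where `N` is the product of the four mixed denominators.
The third expresses `N * (s12 + s34)`, and the discrepancy is exactly `4 (1 - X)(1 - Y)`. The factor
`X = 1` gives the curve; `Y = 1` is excluded by the sign of `(1 + m) l²`. -/
theorem shape_relations_of_scaled_areas {m U l g s12 s13 s14 s23 s24 s34 : ℝ}
    (hm1 : -1 < m) (hm2 : m ≤ 1) (hm0 : m ≠ 0) (hl : l ≠ 0) (hg : g ≠ 0)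
    (h12 : s12 * (1 - m * U * (1 - l ^ 2) / 4) = 1)
    (h34 : s34 * (1 - U * (1 - g ^ 2) / (4 * m)) = 1)
    (h13 : s13 * (1 + U * (1 + l) * (1 + g) / 4) = 1)
    (h14 : s14 * (1 + U * (1 + l) * (1 - g) / 4) = 1)
    (h23 : s23 * (1 + U * (1 - l) * (1 + g) / 4) = 1)
    (h24 : s24 * (1 + U * (1 - l) * (1 - g) / 4) = 1)
    (hF12 : (1 - l) * s12 - (1 + g) * s13 - (1 - g) * s14 =
      (1 + l) * s12 - (1 + g) * s23 - (1 - g) * s24)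
    (hF34 : (1 + l) * s13 + (1 - l) * s23 - (1 - g) * s34 =
      (1 + l) * s14 + (1 - l) * s24 - (1 + g) * s34)
    (hF13 : (1 - l) * s12 - (1 + g) * s13 - (1 - g) * s14 =
      (1 + l) * s13 + (1 - l) * s23 - (1 - g) * s34) :
    (1 + m) * (1 + g ^ 2) = 2 ∧ l ^ 2 = 4 + g ^ 2 ∧ U * (3 + g ^ 2) = 4 := by
  have hm1' : 1 + m ≠ 0 := by linarith
  obtain ⟨D13, hD13⟩ : ∃ D, D = 1 + U * (1 + l) * (1 + g) / 4 := ⟨_, rfl⟩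
  obtain ⟨D14, hD14⟩ : ∃ D, D = 1 + U * (1 + l) * (1 - g) / 4 := ⟨_, rfl⟩
  obtain ⟨D23, hD23⟩ : ∃ D, D = 1 + U * (1 - l) * (1 + g) / 4 := ⟨_, rfl⟩
  obtain ⟨D24, hD24⟩ : ∃ D, D = 1 + U * (1 - l) * (1 - g) / 4 := ⟨_, rfl⟩
  rw [← hD13] at h13
  rw [← hD14] at h14
  rw [← hD23] at h23
  rw [← hD24] at h24
  obtain ⟨X, hX⟩ : ∃ X, X = -(U * (1 - l ^ 2) / 4) := ⟨_, rfl⟩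
  obtain ⟨Y, hY⟩ : ∃ Y, Y = -(U * (1 - g ^ 2) / 4) := ⟨_, rfl⟩
  obtain ⟨N, hN⟩ : ∃ N, N = D13 * D23 * D14 * D24 := ⟨_, rfl⟩
  have hα : s12 * (1 + m * X) = 1 := by linear_combination h12 + s12 * m * hX
  have hβ : s34 * (m + Y) = m := by
    have : s34 * (m + Y) = m * (s34 * (1 - U * (1 - g ^ 2) / (4 * m))) := by
      rw [hY]; field_simp; ring
    rw [this, h34, mul_one]
  have hNne : N ≠ 0 := by
    rw [hN]
    exact mul_ne_zero (mul_ne_zero (mul_ne_zero (right_ne_zero_of_mul_eq_one h13)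
      (right_ne_zero_of_mul_eq_one h23)) (right_ne_zero_of_mul_eq_one h14))
      (right_ne_zero_of_mul_eq_one h24)
  have hNXY : N = (1 - X * Y) ^ 2 + U * (1 - X) * (1 - Y) := by
    rw [hN, hX, hY, hD13, hD14, hD23, hD24]; ring
  -- The differences `s13 - s23` and `s14 - s24` carry a factor `l`, so `hF12` can be divided by `2
  -- * l`.
  have hA' : s12 = U / 4 * ((1 + g) ^ 2 * (s13 * s23) + (1 - g) ^ 2 * (s14 * s24)) := by
    have e1 : s13 - s23 = s13 * s23 * (U * (1 + g) * (-2 * l) / 4) := by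
      have : s13 - s23 = s13 * s23 * (D23 - D13) := by linear_combination s23 * h13 - s13 * h23
      rw [this, hD13, hD23]; ring
    have e2 : s14 - s24 = s14 * s24 * (U * (1 - g) * (-2 * l) / 4) := by
      have : s14 - s24 = s14 * s24 * (D24 - D14) := by linear_combination s24 * h14 - s14 * h24
      rw [this, hD14, hD24]; ring
    apply mul_left_cancel₀ (mul_ne_zero two_ne_zero hl)
    linear_combination -hF12 - (1 + g) * e1 - (1 - g) * e2
  have hB' : s34 = U / 4 * ((1 + l) ^ 2 * (s13 * s14) + (1 - l) ^ 2 * (s23 * s24)) := by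
    have e1 : s13 - s14 = s13 * s14 * (U * (1 + l) * (-2 * g) / 4) := by
      have : s13 - s14 = s13 * s14 * (D14 - D13) := by linear_combination s14 * h13 - s13 * h14
      rw [this, hD13, hD14]; ring
    have e2 : s23 - s24 = s23 * s24 * (U * (1 - l) * (-2 * g) / 4) := by
      have : s23 - s24 = s23 * s24 * (D24 - D23) := by linear_combination s24 * h23 - s23 * h24
      rw [this, hD23, hD24]; ring
    apply mul_left_cancel₀ (mul_ne_zero two_ne_zero hg)
    linear_combination hF34 - (1 + l) * e1 - (1 - l) * e2
  have n1 : N * s13 = D23 * D14 * D24 := by rw [hN]; linear_combination D23 * D14 * D24 * h13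
  have n2 : N * s23 = D13 * D14 * D24 := by rw [hN]; linear_combination D13 * D14 * D24 * h23
  have n3 : N * s14 = D13 * D23 * D24 := by rw [hN]; linear_combination D13 * D23 * D24 * h14
  have n4 : N * s24 = D13 * D23 * D14 := by rw [hN]; linear_combination D13 * D23 * D14 * h24
  have hA : N * s12 = U * (1 - Y) + 2 * Y * (1 - X * Y) := by
    have : N * s12 = U / 4 * ((1 + g) ^ 2 * (D14 * D24) + (1 - g) ^ 2 * (D13 * D23)) := by
      rw [hA']
      linear_combination U / 4 * ((1 + g) ^ 2 * (s23 * n1 + D14 * D24 * h23) +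
        (1 - g) ^ 2 * (s24 * n3 + D13 * D23 * h24))
    rw [this, hX, hY, hD13, hD14, hD23, hD24]; ring
  have hB : N * s34 = U * (1 - X) + 2 * X * (1 - X * Y) := by
    have : N * s34 = U / 4 * ((1 + l) ^ 2 * (D23 * D24) + (1 - l) ^ 2 * (D13 * D14)) := by
      rw [hB']
      linear_combination U / 4 * ((1 + l) ^ 2 * (s14 * n1 + D23 * D24 * h14) +
        (1 - l) ^ 2 * (s24 * n2 + D13 * D14 * h24))
    rw [this, hX, hY, hD13, hD14, hD23, hD24]; ring
  have hC : N * (s12 + s34) = (2 - X - Y) * (2 + U + 2 * X * Y) := by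
    have : 2 * (N * (s12 + s34)) = (2 + l + g) * (D23 * D14 * D24) + (2 - l + g) *
        (D13 * D14 * D24) + (2 + l - g) * (D13 * D23 * D24) + (2 - l - g) * (D13 * D23 * D14) := by
      linear_combination N * (2 * hF13 - hF12 + hF34) + (2 + l + g) * n1 + (2 - l + g) * n2 +
        (2 + l - g) * n3 + (2 - l - g) * n4
    apply mul_left_cancel₀ (two_ne_zero (α := ℝ))
    rw [this, hX, hY, hD13, hD14, hD23, hD24]; ring
  have hXY : (1 - X) * (1 - Y) = 0 := by linear_combination -(hC - hA - hB) / 4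
  rcases mul_eq_zero.mp hXY with h | h
  · have hX1 : X = 1 := by linarith
    rw [hX1] at hNXY hα hA hB
    -- At `X = 1` the product `N` collapses to `(1 - Y) ^ 2`, so one factor `1 - Y` cancels from
    -- `hA` and `hB`.
    have hY1 : 1 - Y ≠ 0 := fun h0 => hNne (by rw [hNXY, one_mul, h0]; ring)
    have e1 : (1 - Y) * s34 = 2 := by
      apply mul_left_cancel₀ hY1
      linear_combination hB - s34 * hNXY
    have e2 : Y * (m + 2) = -m := by linear_combination -(m + Y) * e1 + (1 - Y) * hβ
    have e3 : U * (m + 2) = 2 * (1 + m) := by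
      have : (1 - Y) * s12 = U + 2 * Y := by
        apply mul_left_cancel₀ hY1
        linear_combination hA - s12 * hNXY
      apply mul_left_cancel₀ hm1'
      linear_combination -(m + 2) * (1 + m) * this + (m + 2) * (1 - Y) * hα - (3 + 2 * m) * e2
    rw [hX1] at hX
    have e4 : (1 + m) * (1 + g ^ 2) = 2 := by
      linear_combination 2 * e2 - 2 * (m + 2) * hY + (1 - g ^ 2) / 2 * e3
    refine ⟨e4, ?_, ?_⟩
    · apply mul_left_cancel₀ hm1'
      linear_combination -2 * (m + 2) * hX + (1 - l ^ 2) / 2 * e3 - e4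
    · apply mul_left_cancel₀ hm1'
      linear_combination 2 * e3 + U * e4
  · have hY1 : Y = 1 := by linarith
    rw [hY1] at hNXY hβ hA hB
    have hX1 : 1 - X ≠ 0 := fun h0 => hNne (by rw [hNXY, mul_one, h0]; ring)
    have e1 : (1 - X) * s12 = 2 := by
      apply mul_left_cancel₀ hX1
      linear_combination hA - s12 * hNXY
    have e2 : X * (1 + 2 * m) = -1 := by linear_combination -(1 + m * X) * e1 + (1 - X) * hα
    have e3 : U * (1 + 2 * m) = 2 * (1 + m) := by
      have : (1 - X) * s34 = U + 2 * X := by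
        apply mul_left_cancel₀ hX1
        linear_combination hB - s34 * hNXY
      apply mul_left_cancel₀ hm1'
      linear_combination -(1 + 2 * m) * (1 + m) * this + (1 + 2 * m) * (1 - X) * hβ
        - (2 + 3 * m) * e2
    have e4 : (1 + m) * l ^ 2 = m - 1 := by
      linear_combination 2 * e2 - 2 * (1 + 2 * m) * hX + (1 - l ^ 2) / 2 * e3
    -- Here `m ≤ 1` makes the right side of `e4` nonpositive, while `l ≠ 0` and `m > -1` make the
    -- left side positive.
    exfalso
    have : 0 < (1 + m) * l ^ 2 := mul_pos (by linarith) (by positivity)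
    linarith

/-! ### Consequences of a line of symmetry -/

/-- The reflection permutes the points. Were the permutation trivial, every point would lie on the
mirror, against strict planarity. -/
theorem HasLineOfSymmetry.exists_isometric_involution {n : ℕ} {x : Fin n → Plane}
    (hx : Function.Injective x) (hp : IsStrictlyPlanar x) (h : HasLineOfSymmetry x) :
    ∃ π : Equiv.Perm (Fin n), π * π = 1 ∧ π ≠ 1 ∧
      ∀ i j, dist (x (π i)) (x (π j)) = dist (x i) (x j) := by
  obtain ⟨q, L, hL, himg⟩ := h
  obtain ⟨f, hf⟩ : ∃ f : Plane → Plane, f = fun y => q + L.reflection (y - q) := ⟨_, rfl⟩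
  rw [← hf] at himg
  have hff : ∀ y, f (f y) = y := fun y => by simp [hf]
  have hmaps : ∀ i, ∃ j, x j = f (x i) := fun i => by
    have : f (x i) ∈ f '' Set.range x := ⟨x i, ⟨i, rfl⟩, rfl⟩
    rwa [himg] at this
  choose σ hσ using hmaps
  have hσσ : Function.Involutive σ := fun i => hx (by rw [hσ, hσ, hff])
  refine ⟨hσσ.toPerm, ?_, ?_, fun i j => ?_⟩
  · ext i
    simp [hσσ i]
  · intro h1
    apply hp
    have hfix : ∀ i, x i - q ∈ L := fun i => by
      have h2 : σ i = i := by simpa using congrArg (fun e : Equiv.Perm (Fin n) => e i) h1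
      have h3 := hσ i
      rw [h2, hf] at h3
      rw [← L.reflection_eq_self_iff]
      exact (eq_sub_of_add_eq' h3.symm)
    obtain ⟨v, -, hv⟩ := finrank_eq_one_iff'.1 hL
    rw [collinear_iff_exists_forall_eq_smul_vadd]
    refine ⟨q, v, ?_⟩
    rintro _ ⟨i, rfl⟩
    obtain ⟨c, hc⟩ := hv ⟨x i - q, hfix i⟩
    refine ⟨c, ?_⟩
    have := congrArg Subtype.val hc
    simp only [Submodule.coe_smul] at this
    rw [this]
    simp
  · change dist (x (σ i)) (x (σ j)) = _
    rw [hσ, hσ, hf]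
    simp

theorem perm_fin_four_involution (π : Equiv.Perm (Fin 4)) (h : π * π = 1) (h1 : π ≠ 1) :
    (π 0 = 1 ∧ π 1 = 0 ∧ π 2 = 2 ∧ π 3 = 3) ∨ (π 0 = 2 ∧ π 1 = 1 ∧ π 2 = 0 ∧ π 3 = 3) ∨
    (π 0 = 3 ∧ π 1 = 1 ∧ π 2 = 2 ∧ π 3 = 0) ∨ (π 0 = 0 ∧ π 1 = 2 ∧ π 2 = 1 ∧ π 3 = 3) ∨
    (π 0 = 0 ∧ π 1 = 3 ∧ π 2 = 2 ∧ π 3 = 1) ∨ (π 0 = 0 ∧ π 1 = 1 ∧ π 2 = 3 ∧ π 3 = 2) ∨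
    (π 0 = 1 ∧ π 1 = 0 ∧ π 2 = 3 ∧ π 3 = 2) ∨ (π 0 = 2 ∧ π 1 = 3 ∧ π 2 = 0 ∧ π 3 = 1) ∨
    (π 0 = 3 ∧ π 1 = 2 ∧ π 2 = 1 ∧ π 3 = 0) := by
  revert π
  decide

theorem sum_erase_smul_sub {n : ℕ} (x : Fin n → Plane) (w : Fin n → ℝ) (i : Fin n) :
    ∑ j ∈ Finset.univ.erase i, w j • (x j - x i) = ∑ j, w j • (x j - x i) :=
  Finset.sum_erase _ (by simp)

/-! ### Realizing the curve by configurations -/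

/-- Two vectors of the plane with prescribed Gram matrix. -/
theorem exists_plane_gram {a b c : ℝ} (ha : 0 < a) (hd : b ^ 2 ≤ a * c) :
    ∃ u v : Plane, ‖u‖ ^ 2 = a ∧ inner ℝ u v = b ∧ ‖v‖ ^ 2 = c := by
  have h1 : √a ^ 2 = a := Real.sq_sqrt ha.le
  have h2 : √(c - b ^ 2 / a) ^ 2 = c - b ^ 2 / a := Real.sq_sqrt (by
    rw [sub_nonneg, div_le_iff₀ ha]
    linarith)
  have h3 : √a ≠ 0 := (Real.sqrt_pos.2 ha).ne'
  -- The two vectors are the rows of the Cholesky factor of the Gram matrix.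
  refine ⟨!₂[√a, 0], !₂[b / √a, √(c - b ^ 2 / a)], ?_, ?_, ?_⟩
  · simp [EuclideanSpace.norm_sq_eq, h1]
  · simp [PiLp.inner_apply, h3]
  · simp [EuclideanSpace.norm_sq_eq, h2, div_pow, h1]

/-- The configuration with `x₁ - x₂ = u`, `x₃ - x₄ = v`, whose affine dependence has the
coefficients `1 + l, 1 - l, -(1 + g), -(1 - g)`. -/
noncomputable def framedConfiguration (l g : ℝ) (u v : Plane) : Fin 4 → Plane :=
  ![(g / 2) • v + ((1 - l) / 2) • u, (g / 2) • v - ((1 + l) / 2) • u,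
    (1 / 2 : ℝ) • v, -(1 / 2 : ℝ) • v]

theorem norm_sq_smul_add_smul (u v : Plane) (a b : ℝ) :
    ‖a • u + b • v‖ ^ 2 = a ^ 2 * ‖u‖ ^ 2 + 2 * (a * b) * inner ℝ u v + b ^ 2 * ‖v‖ ^ 2 := by
  rw [norm_add_sq_real, norm_smul, norm_smul, real_inner_smul_left, real_inner_smul_right,
    mul_pow, mul_pow, Real.norm_eq_abs, Real.norm_eq_abs, sq_abs, sq_abs]
  ring

section

variable {l g : ℝ} {u v : Plane}

theorem framedConfiguration_dist (hgl : l ^ 2 = 4 + g ^ 2) (hu : ‖u‖ ^ 2 = (1 + g ^ 2) / 2)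
    (huv : inner ℝ u v = l * g / 2) (hv : ‖v‖ ^ 2 = (3 + g ^ 2) / 2) :
    dist (framedConfiguration l g u v 0) (framedConfiguration l g u v 1) ^ 2 = (1 + g ^ 2) / 2 ∧
    dist (framedConfiguration l g u v 0) (framedConfiguration l g u v 2) ^ 2 =
      (l - 1) * (l - g) / 4 ∧
    dist (framedConfiguration l g u v 0) (framedConfiguration l g u v 3) ^ 2 =
      (l - 1) * (l + g) / 4 ∧
    dist (framedConfiguration l g u v 1) (framedConfiguration l g u v 2) ^ 2 =
      (l + 1) * (l + g) / 4 ∧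
    dist (framedConfiguration l g u v 1) (framedConfiguration l g u v 3) ^ 2 =
      (l + 1) * (l - g) / 4 ∧
    dist (framedConfiguration l g u v 2) (framedConfiguration l g u v 3) ^ 2 =
      (3 + g ^ 2) / 2 := by
  have key : ∀ (y z : Plane) (a b : ℝ), y - z = a • u + b • v → dist y z ^ 2 =
      a ^ 2 * ((1 + g ^ 2) / 2) + 2 * (a * b) * (l * g / 2) + b ^ 2 * ((3 + g ^ 2) / 2) := by
    intro y z a b h
    rw [dist_eq_norm, h, norm_sq_smul_add_smul, hu, huv, hv]
  refine ⟨?_, ?_, ?_, ?_, ?_, ?_⟩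
  · rw [key _ _ 1 0 (by simp [framedConfiguration]; module)]
    ring
  · rw [key _ _ ((1 - l) / 2) ((g - 1) / 2) (by simp [framedConfiguration]; module)]
    linear_combination (-(g - 1) ^ 2 / 8) * hgl
  · rw [key _ _ ((1 - l) / 2) ((g + 1) / 2) (by simp [framedConfiguration]; module)]
    linear_combination (-(g + 1) ^ 2 / 8) * hgl
  · rw [key _ _ (-(1 + l) / 2) ((g - 1) / 2) (by simp [framedConfiguration]; module)]
    linear_combination (-(g - 1) ^ 2 / 8) * hgl
  · rw [key _ _ (-(1 + l) / 2) ((g + 1) / 2) (by simp [framedConfiguration]; module)]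
    linear_combination (-(g + 1) ^ 2 / 8) * hgl
  · rw [key _ _ 0 1 (by simp [framedConfiguration]; module)]
    ring

theorem framedConfiguration_isStrictlyPlanar (h : inner ℝ u v ^ 2 ≠ ‖u‖ ^ 2 * ‖v‖ ^ 2) :
    IsStrictlyPlanar (framedConfiguration l g u v) := by
  intro hc
  rw [collinear_iff_exists_forall_eq_smul_vadd] at hc
  obtain ⟨p, d, hd⟩ := hc
  have hd' := fun i => hd _ ⟨i, rfl⟩
  choose r hr using hd'
  have e1 : u = (r 0 - r 1) • d := by
    calc u = framedConfiguration l g u v 0 - framedConfiguration l g u v 1 := by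
          simp [framedConfiguration]; module
      _ = _ := by rw [hr 0, hr 1]; simp; module
  have e2 : v = (r 2 - r 3) • d := by
    calc v = framedConfiguration l g u v 2 - framedConfiguration l g u v 3 := by
          simp [framedConfiguration]; module
      _ = _ := by rw [hr 2, hr 3]; simp; module
  apply h
  rw [e1, e2, norm_smul, norm_smul, real_inner_smul_left, real_inner_smul_right, mul_pow _ ‖d‖,
    mul_pow _ ‖d‖, Real.norm_eq_abs, Real.norm_eq_abs, sq_abs, sq_abs, real_inner_self_eq_norm_sq]
  ring

theorem framedConfiguration_affine (k : Fin 2) :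
    (1 + l) * framedConfiguration l g u v 0 k + (1 - l) * framedConfiguration l g u v 1 k =
    (1 + g) * framedConfiguration l g u v 2 k + (1 - g) * framedConfiguration l g u v 3 k := by
  simp [framedConfiguration]
  ring

end

/-- With the centre of vorticity as centre of rotation the equations of relative equilibria take
the form `∑ j, Γ j (1 / ‖x i - x j‖² - 1) (x j - x i) = 0`. -/
theorem isRelativeEquilibrium_iff {n : ℕ} {Γ : Fin n → ℝ} {x : Fin n → Plane} {lam : ℝ}
    (hlam : lam = ∑ i, Γ i) (h0 : lam ≠ 0) (hx : Function.Injective x) :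
    IsRelativeEquilibrium Γ x lam ↔
      ∀ i k, ∑ j, Γ j * (1 / dist (x i) (x j) ^ 2 - 1) * (x j k - x i k) = 0 := by
  have hsum : ∀ (c : Plane) (i : Fin n) (k : Fin 2),
      (∑ j ∈ Finset.univ.erase i, (Γ j / dist (x i) (x j) ^ 2) • (x j - x i)) k =
      ∑ j, Γ j * (1 / dist (x i) (x j) ^ 2 - 1) * (x j k - x i k) +
        (∑ j, Γ j * x j k - lam * x i k) := by
    intro c i k
    rw [sum_erase_smul_sub, hlam, Finset.sum_mul, ← Finset.sum_sub_distrib,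
      ← Finset.sum_add_distrib]
    simp only [WithLp.ofLp_sum, Finset.sum_apply, PiLp.smul_apply, PiLp.sub_apply, smul_eq_mul]
    exact Finset.sum_congr rfl fun j _ => by ring
  constructor
  · rintro ⟨-, -, c, hc⟩
    have hck : ∀ i k, -(lam * (x i k - c k)) =
      ∑ j, Γ j * (1 / dist (x i) (x j) ^ 2 - 1) * (x j k - x i k) +
        (∑ j, Γ j * x j k - lam * x i k) := fun i k => by
      rw [← hsum c, ← hc i]
      simp
    -- The interaction is antisymmetric in the two vortices. Weighting the equations by `Γ`
    -- therefore forces `lam * c` to be the moment of vorticity, since `lam ≠ 0`.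
    have hanti : ∀ k, ∑ i, Γ i * ∑ j, Γ j * (1 / dist (x i) (x j) ^ 2 - 1) * (x j k - x i k) = 0 := by
      intro k
      have h1 : ∑ i, Γ i * ∑ j, Γ j * (1 / dist (x i) (x j) ^ 2 - 1) * (x j k - x i k) =
          - ∑ i, Γ i * ∑ j, Γ j * (1 / dist (x i) (x j) ^ 2 - 1) * (x j k - x i k) := by
        conv_rhs => simp only [Finset.mul_sum]
        rw [Finset.sum_comm, ← Finset.sum_neg_distrib]
        refine Finset.sum_congr rfl fun i _ => ?_
        rw [Finset.mul_sum, ← Finset.sum_neg_distrib]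
        refine Finset.sum_congr rfl fun j _ => ?_
        rw [dist_comm]
        ring
      linarith
    have hcen : ∀ k, ∑ j, Γ j * x j k = lam * c k := by
      intro k
      have h1 : ∑ i, Γ i * (lam * c k - ∑ j, Γ j * x j k) = 0 := by
        rw [← hanti k]
        exact Finset.sum_congr rfl fun i _ => by linear_combination Γ i * hck i k
      rw [← Finset.sum_mul, ← hlam] at h1
      linarith [(mul_eq_zero.1 h1).resolve_left h0]
    intro i k
    linear_combination -hck i k - hcen k
  · intro h
    refine ⟨hx, h0, WithLp.toLp 2 fun k => lam⁻¹ * ∑ j, Γ j * x j k, fun i => ?_⟩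
    ext k
    rw [hsum 0, h i k]
    simp
    field_simp
    ring

/-- The parameters of the curve that belong to asymmetric relative equilibria. -/
def asymmetricParameters : Set ℝ := {t | t ≠ 0 ∧ t - t⁻¹ ≠ 0 ∧ (t - t⁻¹) ^ 2 ≠ 1}

theorem ne_zero_of_sq_eq_four_add_sq {l g : ℝ} (hgl : l ^ 2 = 4 + g ^ 2) :
    l ≠ 0 ∧ l - 1 ≠ 0 ∧ l + 1 ≠ 0 ∧ l - g ≠ 0 ∧ l + g ≠ 0 := by
  refine ⟨fun h => ?_, fun h => ?_, fun h => ?_, fun h => ?_, fun h => ?_⟩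
  · nlinarith [sq_nonneg g]
  · nlinarith [sq_nonneg g]
  · nlinarith [sq_nonneg g]
  · exact four_ne_zero (α := ℝ) (by linear_combination (l + g) * h - hgl)
  · exact four_ne_zero (α := ℝ) (by linear_combination (l - g) * h - hgl)

theorem not_hasLineOfSymmetry_of_dist {l g : ℝ} {x : Fin 4 → Plane} (hgl : l ^ 2 = 4 + g ^ 2)
    (hg : g ≠ 0) (hx : Function.Injective x) (hp : IsStrictlyPlanar x)
    (h02 : dist (x 0) (x 2) ^ 2 = (l - 1) * (l - g) / 4)
    (h03 : dist (x 0) (x 3) ^ 2 = (l - 1) * (l + g) / 4)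
    (h12 : dist (x 1) (x 2) ^ 2 = (l + 1) * (l + g) / 4)
    (h13 : dist (x 1) (x 3) ^ 2 = (l + 1) * (l - g) / 4)
    (h23 : dist (x 2) (x 3) ^ 2 = (3 + g ^ 2) / 2) : ¬ HasLineOfSymmetry x := by
  intro hs
  obtain ⟨π, h2, h1, hπ⟩ := hs.exists_isometric_involution hx hp
  obtain ⟨hl0, hl1, hl2, hlg, hlg'⟩ := ne_zero_of_sq_eq_four_add_sq hgl
  have hsq : ∀ i j, dist (x (π i)) (x (π j)) ^ 2 = dist (x i) (x j) ^ 2 := fun i j => by rw [hπ]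
  have e02 := hsq 0 2
  have e03 := hsq 0 3
  have e12 := hsq 1 2
  have e13 := hsq 1 3
  -- Transposing vortices of different pairs equates a mixed distance with `s₃₄ = (l² - 1) / 2`,
  -- which reduces to this linear relation. With the hyperbola it gives `l * δ = -2`, hence `g = 0`.
  have contra : ∀ ε : ℝ, ∀ δ : ℝ, ε ^ 2 = 1 → δ ^ 2 = 1 → l + ε * g = 2 * (l + δ) → False := by
    intro ε δ hε hδ h
    have e : ε * g = l + 2 * δ := by linear_combination h
    have h3 : g ^ 2 = (l + 2 * δ) ^ 2 := by rw [← e, mul_pow, hε, one_mul]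
    have h4 : l * δ = -2 := by linear_combination -(hgl + h3) / 4 - hδ
    have h5 : g ^ 2 = 0 := by
      linear_combination -hgl + (l * δ - 2) * h4 - l ^ 2 * hδ
    exact hg (by simpa using h5)
  rcases perm_fin_four_involution π h2 h1 with ⟨p0, p1, p2, p3⟩ | ⟨p0, p1, p2, p3⟩ |
    ⟨p0, p1, p2, p3⟩ | ⟨p0, p1, p2, p3⟩ | ⟨p0, p1, p2, p3⟩ | ⟨p0, p1, p2, p3⟩ |
    ⟨p0, p1, p2, p3⟩ | ⟨p0, p1, p2, p3⟩ | ⟨p0, p1, p2, p3⟩ <;>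
    simp only [p0, p1, p2, p3, dist_comm (x 3) (x 2), dist_comm (x 3) (x 1), dist_comm (x 3) (x 0),
      dist_comm (x 2) (x 1), dist_comm (x 2) (x 0), dist_comm (x 1) (x 0), h02, h03, h12, h13,
      h23] at e02 e03 e12 e13
  · exact hl0 (by linear_combination (e02 + e03))
  · refine contra 1 1 (by norm_num) (by norm_num) (mul_left_cancel₀ hl1 ?_)
    linear_combination -4 * e03 - 2 * hgl
  · refine contra (-1) 1 (by norm_num) (by norm_num) (mul_left_cancel₀ hl1 ?_)
    linear_combination -4 * e02 - 2 * hgl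
  · refine contra (-1) (-1) (by norm_num) (by norm_num) (mul_left_cancel₀ hl2 ?_)
    linear_combination -4 * e13 - 2 * hgl
  · refine contra 1 (-1) (by norm_num) (by norm_num) (mul_left_cancel₀ hl2 ?_)
    linear_combination -4 * e12 - 2 * hgl
  · apply hg
    have : (l - 1) * g = 0 := by linear_combination 2 * e02
    exact (mul_eq_zero.1 this).resolve_left hl1
  · apply hlg
    linear_combination 2 * e02
  · apply hlg'
    linear_combination 2 * e03
  · apply hlg
    linear_combination 2 * e02

theorem vortexCurve_mem_asymmetricRelativeEquilibria {t : ℝ} (ht : t ∈ asymmetricParameters) :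
    vortexCurve t ∈ asymmetricRelativeEquilibria := by
  obtain ⟨ht0, hg0, hg1⟩ := ht
  obtain ⟨l, hl⟩ : ∃ l, l = t + t⁻¹ := ⟨_, rfl⟩
  obtain ⟨g, hg⟩ : ∃ g, g = t - t⁻¹ := ⟨_, rfl⟩
  have hgl : l ^ 2 = 4 + g ^ 2 := by rw [hl, hg]; field_simp; ring
  rw [← hg] at hg0 hg1
  have hg2 : 0 < g ^ 2 := by positivity
  obtain ⟨-, hl1, hl2, hlg1, hlg2⟩ := ne_zero_of_sq_eq_four_add_sq hgl
  obtain ⟨m, hm⟩ : ∃ m, m = 2 / (1 + g ^ 2) - 1 := ⟨_, rfl⟩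
  have hmg : (1 + m) * (1 + g ^ 2) = 2 := by rw [hm]; field_simp; ring
  have hm1 : 0 < 1 + m := by
    have : 0 < 2 / (1 + g ^ 2) := by positivity
    linarith
  have hm2 : m ≤ 1 := by nlinarith
  have hm0 : m ≠ 0 := fun h => by
    rw [h] at hmg
    exact hg1 (by linarith)
  -- On the hyperbola this Gram matrix has determinant `3/4` for every `t`; it is thus realizable,
  -- and the points are not collinear.
  obtain ⟨u, v, hu, huv, hv⟩ := exists_plane_gram (a := (1 + g ^ 2) / 2) (b := l * g / 2)
    (c := (3 + g ^ 2) / 2) (by positivity) (by rw [div_pow, mul_pow, hgl]; nlinarith)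
  have hpl : IsStrictlyPlanar (framedConfiguration l g u v) := by
    apply framedConfiguration_isStrictlyPlanar
    rw [hu, huv, hv, div_pow, mul_pow, hgl]
    intro h
    nlinarith
  obtain ⟨h01, h02, h03, h12, h13, h23⟩ := framedConfiguration_dist hgl hu huv hv
  have haff := framedConfiguration_affine (l := l) (g := g) (u := u) (v := v)
  obtain ⟨x, hx⟩ : ∃ x, x = framedConfiguration l g u v := ⟨_, rfl⟩
  rw [← hx] at hpl h01 h02 h03 h12 h13 h23 haff
  have hinj : Function.Injective x := by
    have key : ∀ {y z : Plane} {c : ℝ}, dist y z ^ 2 = c → c ≠ 0 → y ≠ z := by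
      rintro y z c h hc rfl
      simp at h
      exact hc h.symm
    have n01 := key h01 (by positivity)
    have n02 := key h02 (by simp [hl1, hlg1])
    have n03 := key h03 (by simp [hl1, hlg2])
    have n12 := key h12 (by simp [hl2, hlg2])
    have n13 := key h13 (by simp [hl2, hlg1])
    have n23 := key h23 (by positivity)
    intro i j h
    fin_cases i <;> fin_cases j <;> first
      | rfl
      | exact absurd h n01
      | exact absurd h n02
      | exact absurd h n03
      | exact absurd h n12
      | exact absurd h n13
      | exact absurd h n23
      | exact absurd h.symm n01
      | exact absurd h.symm n02
      | exact absurd h.symm n03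
      | exact absurd h.symm n12
      | exact absurd h.symm n13
      | exact absurd h.symm n23
  refine ⟨m, 2 + 2 * m, x, by linarith, hm2, hm0, ?_, ?_, hpl,
    not_hasLineOfSymmetry_of_dist hgl hg0 hinj hpl h02 h03 h12 h13 h23, ?_⟩
  · rw [isRelativeEquilibrium_iff _ _ hinj]
    -- Since `(l - g)(l + g) = 4`, the inverse mixed distances become polynomials in `l`, `g` and
    -- the inverses of `l - 1` and `l + 1`.
    · obtain ⟨k₁, hk₁⟩ : ∃ k, k * (l - 1) = 1 := ⟨(l - 1)⁻¹, inv_mul_cancel₀ hl1⟩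
      obtain ⟨k₂, hk₂⟩ : ∃ k, k * (l + 1) = 1 := ⟨(l + 1)⁻¹, inv_mul_cancel₀ hl2⟩
      have d01 : 1 / dist (x 0) (x 1) ^ 2 - 1 = m := by
        rw [h01, hm]
        field_simp
      have d02 : 1 / dist (x 0) (x 2) ^ 2 - 1 = (1 + g) * k₁ := by
        rw [h02, ← eq_one_div_of_mul_eq_one_right (b := (l + g) * k₁)
          (by linear_combination k₁ * (l - 1) / 4 * hgl + hk₁)]
        linear_combination hk₁
      have d03 : 1 / dist (x 0) (x 3) ^ 2 - 1 = (1 - g) * k₁ := by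
        rw [h03, ← eq_one_div_of_mul_eq_one_right (b := (l - g) * k₁)
          (by linear_combination k₁ * (l - 1) / 4 * hgl + hk₁)]
        linear_combination hk₁
      have d12 : 1 / dist (x 1) (x 2) ^ 2 - 1 = -((1 + g) * k₂) := by
        rw [h12, ← eq_one_div_of_mul_eq_one_right (b := (l - g) * k₂)
          (by linear_combination k₂ * (l + 1) / 4 * hgl + hk₂)]
        linear_combination hk₂
      have d13 : 1 / dist (x 1) (x 3) ^ 2 - 1 = -((1 - g) * k₂) := by
        rw [h13, ← eq_one_div_of_mul_eq_one_right (b := (l + g) * k₂)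
          (by linear_combination k₂ * (l + 1) / 4 * hgl + hk₂)]
        linear_combination hk₂
      have hk : (3 + g ^ 2) * (k₁ * k₂) = 1 := by
        linear_combination -k₁ * k₂ * hgl + k₂ * (l + 1) * hk₁ + hk₂
      have d23 : 1 / dist (x 2) (x 3) ^ 2 - 1 = 2 * (k₁ * k₂) - 1 := by
        rw [h23, ← eq_one_div_of_mul_eq_one_right (b := 2 * (k₁ * k₂)) (by linear_combination hk)]
      have d23' : m * (2 * (k₁ * k₂) - 1) = -((1 - g ^ 2) * (k₁ * k₂)) := by
        linear_combination m * hk - k₁ * k₂ * hmg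
      intro i k
      -- Once the `S i j` are inserted, each vortex equation is a multiple of the affine dependence
      -- of the points.
      have ha := haff k
      fin_cases i <;> simp only [Fin.sum_univ_four, vortexStrengths, Fin.zero_eta, Fin.mk_one,
        Fin.reduceFinMk, Matrix.cons_val, sub_self, mul_zero, one_mul, dist_comm (x 3) (x 2),
        dist_comm (x 3) (x 1), dist_comm (x 3) (x 0), dist_comm (x 2) (x 1), dist_comm (x 2) (x 0),
        dist_comm (x 1) (x 0), d01, d02, d03, d12, d13, d23, d23']
      · linear_combination -m * k₁ * ha - m * (x 1 k - x 0 k) * hk₁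
      · linear_combination m * k₂ * ha - m * (x 0 k - x 1 k) * hk₂
      · linear_combination (1 + g) * k₁ * k₂ * ha - (1 + g) * k₁ * (x 0 k - x 2 k) * hk₂ +
          (1 + g) * k₂ * (x 1 k - x 2 k) * hk₁
      · linear_combination (1 - g) * k₁ * k₂ * ha - (1 - g) * k₁ * (x 0 k - x 3 k) * hk₂ +
          (1 - g) * k₂ * (x 1 k - x 3 k) * hk₁
    · simp [vortexStrengths, Fin.sum_univ_succ]; ring
    · linarith
  · have : (∑ i, vortexStrengths m i) = 2 + 2 * m := by
      simp [vortexStrengths, Fin.sum_univ_succ]; ring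
    rw [this, neg_div, div_self (by linarith)]
  · unfold squaredDistancesAndStrength
    rw [h01, h02, h03, h12, h13, h23, hm, hl, hg, vortexCurve]
    ext i
    fin_cases i <;> simp <;> ring

/-! ### Criteria for a line of symmetry -/

/-- The mirror is the perpendicular bisector of `a` and `b`: the hypotheses say that each point and
its partner differ by a multiple of `a - b` and have their midpoint on it. -/
theorem hasLineOfSymmetry_of_involution {n : ℕ} {x : Fin n → Plane} {σ : Fin n → Fin n}
    (hσ : Function.Involutive σ) {a b : Plane} (hab : a ≠ b)
    (h : ∀ i, ∃ ρ : ℝ, x i - x (σ i) = ρ • (a - b))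
    (h' : ∀ i, inner ℝ (a - b) (x i + x (σ i) - (a + b)) = 0) : HasLineOfSymmetry x := by
  obtain ⟨M, hM⟩ : ∃ M : Plane, M = (1 / 2 : ℝ) • (a + b) := ⟨_, rfl⟩
  have hf : ∀ i, M + (ℝ ∙ (a - b))ᗮ.reflection (x i - M) = x (σ i) := fun i => by
    obtain ⟨ρ, hρ⟩ := h i
    have hw : (1 / 2 : ℝ) • (x i + x (σ i) - (a + b)) ∈ (ℝ ∙ (a - b))ᗮ :=
      Submodule.smul_mem _ _ (Submodule.mem_orthogonal_singleton_iff_inner_right.2 (h' i))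
    have e1 : x i - M = (ρ / 2) • (a - b) + (1 / 2 : ℝ) • (x i + x (σ i) - (a + b)) := by
      rw [div_eq_mul_inv, mul_comm, mul_smul, ← hρ, hM]
      module
    rw [e1, map_add, map_smul, Submodule.reflection_orthogonalComplement_singleton_eq_neg,
      Submodule.reflection_mem_subspace_eq_self hw, smul_neg, div_eq_mul_inv, mul_comm, mul_smul,
      ← hρ, hM]
    module
  refine ⟨M, (ℝ ∙ (a - b))ᗮ, ?_, ?_⟩
  · have : Fact (Module.finrank ℝ Plane = 1 + 1) := ⟨by simp⟩
    exact Submodule.finrank_orthogonal_span_singleton (sub_ne_zero.2 hab)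
  · ext y
    constructor
    · rintro ⟨_, ⟨i, rfl⟩, rfl⟩
      exact ⟨σ i, (hf i).symm⟩
    · rintro ⟨i, rfl⟩
      exact ⟨x (σ i), ⟨σ i, rfl⟩, by simp only [hf, hσ i]⟩

theorem inner_sub_add_sub_add (a b y z : Plane) :
    2 * inner ℝ (a - b) (y + z - (a + b)) =
      dist y b ^ 2 - dist y a ^ 2 + (dist z b ^ 2 - dist z a ^ 2) := by
  simp only [dist_eq_norm, EuclideanSpace.norm_sq_eq, Real.norm_eq_abs, sq_abs, PiLp.inner_apply,
    Fin.sum_univ_two, PiLp.sub_apply, PiLp.add_apply, RCLike.inner_apply, conj_trivial]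
  ring

theorem hasLineOfSymmetry_of_equidistant {n : ℕ} {x : Fin n → Plane} {a b : Fin n}
    (hab : x a ≠ x b)
    (h : ∀ i, i ≠ a → i ≠ b → dist (x i) (x a) ^ 2 = dist (x i) (x b) ^ 2) :
    HasLineOfSymmetry x := by
  refine hasLineOfSymmetry_of_involution (σ := Equiv.swap a b)
    (fun i => Equiv.swap_apply_self a b i) hab (fun i => ?_) fun i => ?_
  · rcases eq_or_ne i a with rfl | hia
    · exact ⟨1, by simp⟩
    · rcases eq_or_ne i b with rfl | hib
      · exact ⟨-1, by simp⟩
      · exact ⟨0, by simp [Equiv.swap_apply_of_ne_of_ne hia hib]⟩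
  · rcases eq_or_ne i a with rfl | hia
    · simp
    · rcases eq_or_ne i b with rfl | hib
      · simp [add_comm]
      · have := inner_sub_add_sub_add (x a) (x b) (x i) (x i)
        rw [h i hia hib] at this
        rw [Equiv.swap_apply_of_ne_of_ne hia hib]
        linarith

/-! ### From signed areas to the parameter -/

/-- The coefficient matrix is symmetric with zero diagonal and determinant `2 p q r`. -/
theorem eq_zero_of_alternating_system {b c d p q r : ℝ} (hp : p ≠ 0) (hq : q ≠ 0) (hr : r ≠ 0)
    (h1 : c * p + d * q = 0) (h2 : b * p + d * r = 0) (h3 : b * q + c * r = 0) :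
    b = 0 ∧ c = 0 ∧ d = 0 := by
  have hb : b = 0 := by
    have : b * (2 * (p * q)) = 0 := by linear_combination q * h2 + p * h3 - r * h1
    exact (mul_eq_zero.1 this).resolve_right (by simp [hp, hq])
  subst hb
  simp [hr] at h2 h3
  exact ⟨rfl, h3, h2⟩

/-- If one of four points is at distance one from the others and its coefficient in an affine
dependence of the four points vanishes, then so do the other coefficients. -/
theorem eq_zero_of_unit_distances {A B C D sAB sAC sAD sBC sBD sCD : ℝ} (hA : A = 0)
    (hsum : A + B + C + D = 0) (hBC : sBC ≠ 0) (hBD : sBD ≠ 0) (hCD : sCD ≠ 0)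
    (h1 : sAB = 1) (h2 : sAC = 1) (h3 : sAD = 1)
    (e1 : B * sAB + C * sAC + D * sAD = A * sAB + C * sBC + D * sBD)
    (e2 : B * sAB + C * sAC + D * sAD = A * sAC + B * sBC + D * sCD)
    (e3 : B * sAB + C * sAC + D * sAD = A * sAD + B * sBD + C * sCD) :
    B = 0 ∧ C = 0 ∧ D = 0 := by
  subst hA h1 h2 h3
  exact eq_zero_of_alternating_system hBC hBD hCD (by linarith) (by linarith) (by linarith)

/-- Once `A0` and `A2` are nonzero, `τ` is read off from `S02` and the proportions give the rest. If
one of these areas vanished, the proportions would put its vortex at distance one from the others,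
and the constancy of `∑ j, A j * s i j` would annihilate all the areas. -/
theorem shape_factorization {m A0 A1 A2 A3 s01 s02 s03 s12 s13 s23 S01 S02 S03 S12 S13 S23 : ℝ}
    (hm : m ≠ 0) (hA : ¬ (A0 = 0 ∧ A1 = 0 ∧ A2 = 0 ∧ A3 = 0)) (hsum : A0 + A1 + A2 + A3 = 0)
    (h01 : s01 * (1 + S01) = 1) (h02 : s02 * (1 + S02) = 1) (h03 : s03 * (1 + S03) = 1)
    (h12 : s12 * (1 + S12) = 1) (h13 : s13 * (1 + S13) = 1) (h23 : s23 * (1 + S23) = 1)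
    (r0a : S01 * A2 = m * S02 * A1) (r0c : S02 * A3 = S03 * A2)
    (r1a : S01 * A2 = m * S12 * A0) (r1b : S01 * A3 = m * S13 * A0) (r1c : S12 * A3 = S13 * A2)
    (r2a : S02 * A1 = S12 * A0) (r2b : S02 * A3 = m * S23 * A0) (r2c : S12 * A3 = m * S23 * A1)
    (r3a : S03 * A1 = S13 * A0) (r3b : S03 * A2 = m * S23 * A0)
    (e1 : A1 * s01 + A2 * s02 + A3 * s03 = A0 * s01 + A2 * s12 + A3 * s13)
    (e2 : A1 * s01 + A2 * s02 + A3 * s03 = A0 * s02 + A1 * s12 + A3 * s23)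
    (e3 : A1 * s01 + A2 * s02 + A3 * s03 = A0 * s03 + A1 * s13 + A2 * s23) :
    A2 ≠ 0 ∧ ∃ τ, S01 = m * τ * A0 * A1 ∧ S02 = τ * A0 * A2 ∧ S03 = τ * A0 * A3 ∧
      S12 = τ * A1 * A2 ∧ S13 = τ * A1 * A3 ∧ m * S23 = τ * A2 * A3 := by
  have unit : ∀ {s S : ℝ}, s * (1 + S) = 1 → S = 0 → s = 1 := fun h h' => by
    rw [h'] at h
    linarith
  have key : ∀ {S B C D : ℝ}, B + C + D = 0 → ¬ (B = 0 ∧ C = 0 ∧ D = 0) → S * B = 0 → S * C = 0 →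
      S = 0 := fun {S B C D} hs hn h1 h2 => by
    by_contra hS
    have hB := (mul_eq_zero.1 h1).resolve_left hS
    have hC := (mul_eq_zero.1 h2).resolve_left hS
    exact hn ⟨hB, hC, by linarith⟩
  have hA0 : A0 ≠ 0 := by
    intro h0
    have hn : ¬ (A1 = 0 ∧ A2 = 0 ∧ A3 = 0) := fun h => hA ⟨h0, h⟩
    rw [h0, mul_zero] at r1a r1b r2a r2b r3a r3b
    have z1 : S01 = 0 := key (B := A2) (C := A3) (D := A1) (by linarith) (by tauto) r1a r1b
    have z2 : S02 = 0 := key (B := A1) (C := A3) (D := A2) (by linarith) (by tauto) r2a r2b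
    have z3 : S03 = 0 := key (B := A1) (C := A2) (D := A3) (by linarith) (by tauto) r3a r3b
    exact hn (eq_zero_of_unit_distances h0 hsum (left_ne_zero_of_mul_eq_one h12)
      (left_ne_zero_of_mul_eq_one h13) (left_ne_zero_of_mul_eq_one h23) (unit h01 z1) (unit h02 z2)
      (unit h03 z3) e1 e2 e3)
  have hA2 : A2 ≠ 0 := by
    intro h0
    have hn : ¬ (A0 = 0 ∧ A1 = 0 ∧ A3 = 0) := fun h => hA ⟨h.1, h.2.1, h0, h.2.2⟩
    rw [h0, mul_zero] at r0a r0c r1a r1c r3b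
    have z0 : S02 = 0 := key (B := A1) (C := A3) (D := A0) (by linarith) (by tauto)
      (by simpa [hm] using r0a.symm) r0c
    have z1 : S12 = 0 := key (B := A0) (C := A3) (D := A1) (by linarith) (by tauto)
      (by simpa [hm] using r1a.symm) r1c
    have z3 : S23 = 0 := key (B := A0) (C := A1) (D := A3) (by linarith) (by tauto)
      (by simpa [hm] using r3b.symm) (by
        rw [z1, zero_mul] at r2c
        simpa [hm] using r2c.symm)
    exact hn (eq_zero_of_unit_distances (sBC := s01) (sBD := s03) (sCD := s13) h0 (by linarith)
      (left_ne_zero_of_mul_eq_one h01)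
      (left_ne_zero_of_mul_eq_one h03) (left_ne_zero_of_mul_eq_one h13) (unit h02 z0) (unit h12 z1)
      (unit h23 z3) (by linarith) (by linarith) (by linarith))
  refine ⟨hA2, S02 / (A0 * A2), ?_, ?_, ?_, ?_, ?_, ?_⟩
  · field_simp
    linear_combination r0a
  · field_simp
  · field_simp
    linear_combination -r0c
  · field_simp
    linear_combination -r2a
  · field_simp
    linear_combination -A2 * r3a - A1 * r0c
  · field_simp
    linear_combination -r2b

theorem squared_distances_of_shape_relations {m U l g s12 s13 s14 s23 s24 s34 : ℝ}
    (hm0 : m ≠ 0) (hmg : (1 + m) * (1 + g ^ 2) = 2) (hgl : l ^ 2 = 4 + g ^ 2)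
    (hU : U * (3 + g ^ 2) = 4)
    (h12 : s12 * (1 - m * U * (1 - l ^ 2) / 4) = 1)
    (h34 : s34 * (1 - U * (1 - g ^ 2) / (4 * m)) = 1)
    (h13 : s13 * (1 + U * (1 + l) * (1 + g) / 4) = 1)
    (h14 : s14 * (1 + U * (1 + l) * (1 - g) / 4) = 1)
    (h23 : s23 * (1 + U * (1 - l) * (1 + g) / 4) = 1)
    (h24 : s24 * (1 + U * (1 - l) * (1 - g) / 4) = 1) :
    s12 = (1 + g ^ 2) / 2 ∧ s13 = (l - 1) * (l - g) / 4 ∧ s14 = (l - 1) * (l + g) / 4 ∧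
      s23 = (l + 1) * (l + g) / 4 ∧ s24 = (l + 1) * (l - g) / 4 ∧ s34 = (3 + g ^ 2) / 2 := by
  -- The four mixed distances differ only by the signs of `l` and `g`. The computation rests on `(3
  -- + g²) + (1 + l)(1 + g) = (l + 1)(l + g)`.
  have key : ∀ {l g s : ℝ}, l ^ 2 = 4 + g ^ 2 → U * (3 + g ^ 2) = 4 →
      s * (1 + U * (1 + l) * (1 + g) / 4) = 1 → s = (l - 1) * (l - g) / 4 := by
    intro l g s hgl hU h
    have hl := (ne_zero_of_sq_eq_four_add_sq hgl).2.2.1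
    have h1 : (l + 1) * (s * (l + g)) = (l + 1) * (l - 1) := by
      linear_combination (3 + g ^ 2) * h - s * (1 + l) * (1 + g) / 4 * hU + (s - 1) * hgl
    have h2 := mul_left_cancel₀ hl h1
    linear_combination (l - g) / 4 * h2 - s / 4 * hgl
  have e13 := key hgl hU h13
  have e14 := key (l := l) (g := -g) (s := s14) (by linear_combination hgl)
    (by linear_combination hU) (by linear_combination h14)
  have e23 := key (l := -l) (g := g) (s := s23) (by linear_combination hgl)
    hU (by linear_combination h23)
  have e24 := key (l := -l) (g := -g) (s := s24) (by linear_combination hgl)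
    (by linear_combination hU) (by linear_combination h24)
  refine ⟨?_, e13, ?_, ?_, ?_, ?_⟩
  · have h : s12 * (1 + m) = 1 := by
      linear_combination h12 - s12 * m * U / 4 * hgl - s12 * m / 4 * hU
    linear_combination (1 + g ^ 2) / 2 * h - s12 / 2 * hmg
  · rw [e14]; ring
  · rw [e23]; ring
  · rw [e24]; ring
  · have h : s34 * (1 - U * (1 + g ^ 2) / 4) = 1 := by
      have e : U * (1 - g ^ 2) / (4 * m) = U * (1 + g ^ 2) / 4 := by
        rw [div_eq_div_iff (by positivity) four_ne_zero]
        linear_combination -4 * U * hmg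
      rw [← e, h34]
    linear_combination (3 + g ^ 2) / 2 * h + s34 * (1 + g ^ 2) / 8 * hU

theorem exists_parameter_of_factorization
    {m τ A0 A1 A2 A3 s01 s02 s03 s12 s13 s23 S01 S02 S03 S12 S13 S23 : ℝ}
    (hm1 : -1 < m) (hm2 : m ≤ 1) (hm : m ≠ 0) (hsum : A0 + A1 + A2 + A3 = 0)
    (hA01 : A0 + A1 ≠ 0) (hl : A0 - A1 ≠ 0) (hg : A2 - A3 ≠ 0)
    (h01 : s01 * (1 + S01) = 1) (h02 : s02 * (1 + S02) = 1) (h03 : s03 * (1 + S03) = 1)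
    (h12 : s12 * (1 + S12) = 1) (h13 : s13 * (1 + S13) = 1) (h23 : s23 * (1 + S23) = 1)
    (f01 : S01 = m * τ * A0 * A1) (f02 : S02 = τ * A0 * A2) (f03 : S03 = τ * A0 * A3)
    (f12 : S12 = τ * A1 * A2) (f13 : S13 = τ * A1 * A3) (f23 : m * S23 = τ * A2 * A3)
    (e1 : A1 * s01 + A2 * s02 + A3 * s03 = A0 * s01 + A2 * s12 + A3 * s13)
    (e2 : A1 * s01 + A2 * s02 + A3 * s03 = A0 * s02 + A1 * s12 + A3 * s23)
    (e3 : A1 * s01 + A2 * s02 + A3 * s03 = A0 * s03 + A1 * s13 + A2 * s23) :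
    ∃ t ∈ asymmetricParameters, ![s01, s02, s03, s12, s13, s23, m] = vortexCurve t := by
  -- Scaling by `B` makes the areas of the first pair sum to `2` and, by `hsum`, those of the second
  -- to `-2`.
  obtain ⟨B, hB⟩ : ∃ B, B * (A0 + A1) = 2 := ⟨2 / (A0 + A1), div_mul_cancel₀ _ hA01⟩
  have hB0 : B ≠ 0 := left_ne_zero_of_mul (hB ▸ two_ne_zero)
  obtain ⟨l, hl'⟩ : ∃ l, l = B * (A0 - A1) / 2 := ⟨_, rfl⟩
  obtain ⟨g, hg'⟩ : ∃ g, g = -(B * (A2 - A3) / 2) := ⟨_, rfl⟩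
  obtain ⟨U, hU'⟩ : ∃ U, U = -(τ * (A0 + A1) ^ 2) := ⟨_, rfl⟩
  have a0 : B * A0 = 1 + l := by linear_combination hB / 2 - hl'
  have a1 : B * A1 = 1 - l := by linear_combination hB / 2 + hl'
  have a2 : B * A2 = -(1 + g) := by linear_combination -hB / 2 + hg' + B / 2 * hsum
  have a3 : B * A3 = -(1 - g) := by linear_combination -hB / 2 - hg' + B / 2 * hsum
  have hUB : U * B ^ 2 = -4 * τ := by
    rw [hU']
    linear_combination -τ * (B * (A0 + A1) + 2) * hB
  have hτ : ∀ {x y a b : ℝ}, B * x = a → B * y = b → U * a * b / 4 = -(τ * x * y) := by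
    rintro x y _ _ rfl rfl
    linear_combination x * y / 4 * hUB
  have c01 := hτ a0 a1
  have c02 := hτ a0 a2
  have c03 := hτ a0 a3
  have c12 := hτ a1 a2
  have c13 := hτ a1 a3
  have c23 := hτ a2 a3
  have k01 : s01 * (1 - m * U * (1 - l ^ 2) / 4) = 1 := by
    linear_combination h01 - s01 * f01 - s01 * m * c01
  have k02 : s02 * (1 + U * (1 + l) * (1 + g) / 4) = 1 := by
    linear_combination h02 - s02 * f02 - s02 * c02
  have k03 : s03 * (1 + U * (1 + l) * (1 - g) / 4) = 1 := by
    linear_combination h03 - s03 * f03 - s03 * c03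
  have k12 : s12 * (1 + U * (1 - l) * (1 + g) / 4) = 1 := by
    linear_combination h12 - s12 * f12 - s12 * c12
  have k13 : s13 * (1 + U * (1 - l) * (1 - g) / 4) = 1 := by
    linear_combination h13 - s13 * f13 - s13 * c13
  have k23 : s23 * (1 - U * (1 - g ^ 2) / (4 * m)) = 1 := by
    have : S23 = -(U * (1 - g ^ 2) / (4 * m)) := by
      field_simp
      linear_combination 4 * f23 + 4 * c23
    linear_combination h23 - s23 * this
  obtain ⟨hmg, hgl, hU⟩ := shape_relations_of_scaled_areas (m := m) (U := U) (l := l) (g := g)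
    hm1 hm2 hm (by rw [hl']; positivity) (by rw [hg']; simp [hB0, hg]) k01 k23 k02 k03 k12 k13
    (by linear_combination B * e1 - s01 * (a1 - a0) - s02 * a2 - s03 * a3 + s12 * a2 + s13 * a3)
    (by linear_combination B * (e3 - e2) - s02 * a0 - s12 * a1 - s23 * (a3 - a2) + s03 * a0 +
      s13 * a1)
    (by linear_combination B * e2 - s01 * a1 - s02 * (a2 - a0) - s03 * a3 + s12 * a1 + s23 * a3)
  obtain ⟨q01, q02, q03, q12, q13, q23⟩ :=
    squared_distances_of_shape_relations hm hmg hgl hU k01 k23 k02 k03 k12 k13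
  have hlg := (ne_zero_of_sq_eq_four_add_sq hgl).2.2.2.2
  have hinv : ((l + g) / 2)⁻¹ = (l - g) / 2 := by
    apply inv_eq_of_mul_eq_one_right
    linear_combination hgl / 4
  have hgne : g ≠ 0 := by rw [hg']; simp [hB0, hg]
  -- On the hyperbola `(l + g) / 2` and `(l - g) / 2` are mutually inverse.
  refine ⟨(l + g) / 2, ⟨?_, ?_, ?_⟩, ?_⟩
  · simp [hlg]
  · rw [hinv]
    ring_nf
    exact hgne
  · rw [hinv]
    intro h
    apply hm
    have : g ^ 2 = 1 := by linear_combination h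
    rw [this] at hmg
    linarith
  · rw [vortexCurve, hinv, q01, q02, q03, q12, q13, q23]
    have hm' : m = 2 / (1 + g ^ 2) - 1 := by
      field_simp
      linear_combination hmg
    rw [hm']
    have e : (l + g) / 2 - (l - g) / 2 = g := by ring
    ext i
    fin_cases i <;> simp [e] <;> ring

/-! ### Signed areas of an equilibrium -/

/-- Twice the signed area of the triangle `a b c`. -/
noncomputable def signedArea (a b c : Plane) : ℝ :=
  (b 0 - a 0) * (c 1 - a 1) - (c 0 - a 0) * (b 1 - a 1)

theorem plane_dist_sq (y z : Plane) : dist y z ^ 2 = (y 0 - z 0) ^ 2 + (y 1 - z 1) ^ 2 := by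
  simp [dist_eq_norm, EuclideanSpace.norm_sq_eq, Fin.sum_univ_two]

theorem exists_eq_smul_of_signedArea_eq_zero {a b c : Plane} (hab : a ≠ b)
    (h : signedArea a b c = 0) : ∃ r : ℝ, c - a = r • (b - a) := by
  have hne : (b 0 - a 0) ^ 2 + (b 1 - a 1) ^ 2 ≠ 0 := by
    rw [← plane_dist_sq]
    exact pow_ne_zero 2 (dist_ne_zero.2 hab.symm)
  unfold signedArea at h
  refine ⟨((c 0 - a 0) * (b 0 - a 0) + (c 1 - a 1) * (b 1 - a 1)) /
    ((b 0 - a 0) ^ 2 + (b 1 - a 1) ^ 2), ?_⟩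
  ext k
  fin_cases k <;> simp only [Fin.zero_eta, Fin.mk_one, PiLp.smul_apply, PiLp.sub_apply, smul_eq_mul]
  · rw [div_mul_eq_mul_div, eq_div_iff hne]
    linear_combination -(b 1 - a 1) * h
  · rw [div_mul_eq_mul_div, eq_div_iff hne]
    linear_combination (b 0 - a 0) * h

theorem not_isStrictlyPlanar_of_signedArea_eq_zero {x : Fin 4 → Plane} (h01 : x 0 ≠ x 1)
    (h2 : signedArea (x 0) (x 1) (x 2) = 0) (h3 : signedArea (x 0) (x 1) (x 3) = 0) :
    ¬ IsStrictlyPlanar x := by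
  obtain ⟨r, hr⟩ := exists_eq_smul_of_signedArea_eq_zero h01 h2
  obtain ⟨s, hs⟩ := exists_eq_smul_of_signedArea_eq_zero h01 h3
  intro h
  apply h
  rw [collinear_iff_exists_forall_eq_smul_vadd]
  refine ⟨x 0, x 1 - x 0, ?_⟩
  rintro _ ⟨i, rfl⟩
  fin_cases i
  · exact ⟨0, by simp⟩
  · exact ⟨1, by simp⟩
  · exact ⟨r, by simp [← hr]⟩
  · exact ⟨s, by simp [← hs]⟩

theorem exists_parameter_of_mem_asymmetricRelativeEquilibria {p : Fin 7 → ℝ}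
    (hp : p ∈ asymmetricRelativeEquilibria) : ∃ t ∈ asymmetricParameters, p = vortexCurve t := by
  obtain ⟨m, lam, x, hm1, hm2, hm0, hre, hlam, hpl, hsym, rfl⟩ := hp
  have hΓ : ∑ i, vortexStrengths m i = 2 + 2 * m := by
    simp [vortexStrengths, Fin.sum_univ_succ]; ring
  have hpos : 2 + 2 * m ≠ 0 := by linarith
  have hlam' : lam = ∑ i, vortexStrengths m i := by
    rw [hΓ] at hlam ⊢
    rw [div_eq_iff hpos] at hlam
    linarith
  have hinj := hre.1
  have hrow := (isRelativeEquilibrium_iff hlam' hre.2.1 hinj).1 hre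
  have hs : ∀ {i j : Fin 4}, i ≠ j →
      dist (x i) (x j) ^ 2 * (1 + (1 / dist (x i) (x j) ^ 2 - 1)) = 1 := fun {i j} hij => by
    have : dist (x i) (x j) ^ 2 ≠ 0 := pow_ne_zero 2 (dist_ne_zero.2 (hinj.ne hij))
    rw [add_sub_cancel, mul_one_div_cancel this]
  obtain ⟨S, hS⟩ : ∃ S : Fin 4 → Fin 4 → ℝ, S = fun i j => 1 / dist (x i) (x j) ^ 2 - 1 := ⟨_, rfl⟩
  have hSij : ∀ i j, 1 / dist (x i) (x j) ^ 2 - 1 = S i j := fun i j => by rw [hS]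
  have hScomm : ∀ i j, S i j = S j i := fun i j => by rw [hS]; simp only [dist_comm]
  simp only [hSij] at hrow hs
  have w0 := hrow 0
  have w1 := hrow 1
  have w2 := hrow 2
  have w3 := hrow 3
  simp only [Fin.sum_univ_four, vortexStrengths, Matrix.cons_val, sub_self, mul_zero, one_mul,
    hScomm 3 2, hScomm 3 1, hScomm 3 0, hScomm 2 1, hScomm 2 0, hScomm 1 0] at w0 w1 w2 w3
  obtain ⟨A0, hA0⟩ : ∃ A, A = signedArea (x 1) (x 2) (x 3) := ⟨_, rfl⟩
  obtain ⟨A1, hA1⟩ : ∃ A, A = -signedArea (x 0) (x 2) (x 3) := ⟨_, rfl⟩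
  obtain ⟨A2, hA2⟩ : ∃ A, A = signedArea (x 0) (x 1) (x 3) := ⟨_, rfl⟩
  obtain ⟨A3, hA3⟩ : ∃ A, A = -signedArea (x 0) (x 1) (x 2) := ⟨_, rfl⟩
  have hnz : ¬ (A0 = 0 ∧ A1 = 0 ∧ A2 = 0 ∧ A3 = 0) := fun h =>
    not_isStrictlyPlanar_of_signedArea_eq_zero (hinj.ne (by decide)) (by linarith [h.2.2.2])
      (by linarith [h.2.2.1]) hpl
  unfold signedArea at hA0 hA1 hA2 hA3
  have hsum : A0 + A1 + A2 + A3 = 0 := by rw [hA0, hA1, hA2, hA3]; ring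
  have hmom : ∀ k, A0 * x 0 k + A1 * x 1 k + A2 * x 2 k + A3 * x 3 k = 0 := fun k => by
    rw [hA0, hA1, hA2, hA3]
    fin_cases k <;> simp only [Fin.zero_eta, Fin.mk_one] <;> ring
  -- Expanding the squares and using `hsum` and `hmom`, each side reduces to the same sum of `A k *
  -- ‖x k‖²`.
  have hF : ∀ i j, A0 * dist (x i) (x 0) ^ 2 + A1 * dist (x i) (x 1) ^ 2 +
      A2 * dist (x i) (x 2) ^ 2 + A3 * dist (x i) (x 3) ^ 2 =
      A0 * dist (x j) (x 0) ^ 2 + A1 * dist (x j) (x 1) ^ 2 +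
      A2 * dist (x j) (x 2) ^ 2 + A3 * dist (x j) (x 3) ^ 2 := fun i j => by
    simp only [plane_dist_sq]
    linear_combination (x i 0 ^ 2 + x i 1 ^ 2 - x j 0 ^ 2 - x j 1 ^ 2) * hsum -
      2 * (x i 0 - x j 0) * hmom 0 - 2 * (x i 1 - x j 1) * hmom 1
  have e1 := hF 0 1
  have e2 := hF 0 2
  have e3 := hF 0 3
  simp only [dist_self, dist_comm (x 3) (x 2), dist_comm (x 3) (x 1), dist_comm (x 3) (x 0),
    dist_comm (x 2) (x 1), dist_comm (x 2) (x 0), dist_comm (x 1) (x 0)] at e1 e2 e3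
  obtain ⟨hA2ne, τ, f01, f02, f03, f12, f13, f23⟩ := shape_factorization hm0 hnz hsum
    (hs (i := 0) (j := 1) (by decide)) (hs (i := 0) (j := 2) (by decide))
    (hs (i := 0) (j := 3) (by decide)) (hs (i := 1) (j := 2) (by decide))
    (hs (i := 1) (j := 3) (by decide)) (hs (i := 2) (j := 3) (by decide))
    -- Crossing the equation of a vortex with an edge from it removes the other end of that edge;
    -- the two remaining terms are signed areas.
    (by rw [hA2, hA1]; linear_combination (x 3 1 - x 0 1) * w0 0 - (x 3 0 - x 0 0) * w0 1)
    (by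
      apply mul_left_cancel₀ hm0
      rw [hA3, hA2]; linear_combination (x 1 1 - x 0 1) * w0 0 - (x 1 0 - x 0 0) * w0 1)
    (by rw [hA2, hA0]; linear_combination (x 3 0 - x 1 0) * w1 1 - (x 3 1 - x 1 1) * w1 0)
    (by rw [hA3, hA0]; linear_combination (x 2 1 - x 1 1) * w1 0 - (x 2 0 - x 1 0) * w1 1)
    (by
      apply mul_left_cancel₀ hm0
      rw [hA3, hA2]; linear_combination (x 0 0 - x 1 0) * w1 1 - (x 0 1 - x 1 1) * w1 0)
    (by rw [hA1, hA0]; linear_combination (x 3 1 - x 2 1) * w2 0 - (x 3 0 - x 2 0) * w2 1)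
    (by rw [hA3, hA0]; linear_combination (x 1 0 - x 2 0) * w2 1 - (x 1 1 - x 2 1) * w2 0)
    (by rw [hA3, hA1]; linear_combination (x 0 1 - x 2 1) * w2 0 - (x 0 0 - x 2 0) * w2 1)
    (by rw [hA1, hA0]; linear_combination (x 2 0 - x 3 0) * w3 1 - (x 2 1 - x 3 1) * w3 0)
    (by rw [hA2, hA0]; linear_combination (x 1 1 - x 3 1) * w3 0 - (x 1 0 - x 3 0) * w3 1)
    (by linear_combination e1) (by linear_combination e2) (by linear_combination e3)
  have hdist : ∀ {i j k l : Fin 4}, i ≠ j → k ≠ l → S i j = S k l →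
      dist (x i) (x j) ^ 2 = dist (x k) (x l) ^ 2 := fun hij hkl h => by
    have h1 := hs hij
    have h2 := hs hkl
    rw [h] at h1
    exact mul_right_cancel₀ (right_ne_zero_of_mul_eq_one h2) (h1.trans h2.symm)
  -- Equal areas in the first pair make both vortices of the second pair equidistant from it.
  have n01 : A0 - A1 ≠ 0 := fun h => hsym <| by
    have h : A0 = A1 := by linarith
    rw [h] at f02 f03
    refine hasLineOfSymmetry_of_equidistant (hinj.ne (show (0 : Fin 4) ≠ 1 by decide))
      fun i hi0 hi1 => hdist hi0 hi1 ?_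
    fin_cases i
    · exact absurd rfl hi0
    · exact absurd rfl hi1
    · exact (hScomm 2 0).trans ((f02.trans f12.symm).trans (hScomm 1 2))
    · exact (hScomm 3 0).trans ((f03.trans f13.symm).trans (hScomm 1 3))
  have n23 : A2 - A3 ≠ 0 := fun h => hsym <| by
    have h : A2 = A3 := by linarith
    rw [h] at f02 f12
    refine hasLineOfSymmetry_of_equidistant (hinj.ne (show (2 : Fin 4) ≠ 3 by decide))
      fun i hi0 hi1 => hdist hi0 hi1 ?_
    fin_cases i
    · exact f02.trans f03.symm
    · exact f12.trans f13.symm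
    · exact absurd rfl hi0
    · exact absurd rfl hi1
  -- Otherwise the two pairs span parallel segments with a common perpendicular bisector, as in an
  -- isosceles trapezoid.
  have nsum : A0 + A1 ≠ 0 := fun h => hsym <| by
    have h1 : A1 = -A0 := by linarith
    have h3 : A3 = -A2 := by linarith
    have d1 : dist (x 0) (x 2) ^ 2 = dist (x 1) (x 3) ^ 2 :=
      hdist (by decide) (by decide) (by rw [f02, f13, h1, h3]; ring)
    have d2 : dist (x 0) (x 3) ^ 2 = dist (x 1) (x 2) ^ 2 :=
      hdist (by decide) (by decide) (by rw [f03, f12, h1, h3]; ring)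
    have hpar : x 2 - x 3 = (-(A0 / A2)) • (x 0 - x 1) := by
      ext k
      have := hmom k
      rw [h1, h3] at this
      simp only [PiLp.smul_apply, PiLp.sub_apply, smul_eq_mul]
      field_simp
      linear_combination this
    refine hasLineOfSymmetry_of_involution (σ := ![1, 0, 3, 2])
      (fun i => by fin_cases i <;> rfl)
      (hinj.ne (show (0 : Fin 4) ≠ 1 by decide)) (fun i => ?_) fun i => ?_
    · fin_cases i
      · exact ⟨1, by simp⟩
      · exact ⟨-1, by simp⟩
      · exact ⟨_, hpar⟩
      · exact ⟨A0 / A2, by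
          change x 3 - x 2 = _
          rw [← neg_sub, hpar, neg_smul, neg_neg]⟩
    · have h23 : inner ℝ (x 0 - x 1) (x 2 + x 3 - (x 0 + x 1)) = 0 := by
        have := inner_sub_add_sub_add (x 0) (x 1) (x 2) (x 3)
        rw [dist_comm (x 2) (x 1), dist_comm (x 2) (x 0), dist_comm (x 3) (x 1),
          dist_comm (x 3) (x 0)] at this
        linarith
      fin_cases i
      · simp
      · change inner ℝ (x 0 - x 1) (x 1 + x 0 - (x 0 + x 1)) = 0
        rw [add_comm (x 1), sub_self, inner_zero_right]
      · exact h23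
      · change inner ℝ (x 0 - x 1) (x 3 + x 2 - (x 0 + x 1)) = 0
        rwa [add_comm (x 3)]
  exact exists_parameter_of_factorization hm1 hm2 hm0 hsum nsum n01 n23
    (hs (i := 0) (j := 1) (by decide)) (hs (i := 0) (j := 2) (by decide))
    (hs (i := 0) (j := 3) (by decide)) (hs (i := 1) (j := 2) (by decide))
    (hs (i := 1) (j := 3) (by decide)) (hs (i := 2) (j := 3) (by decide)) f01 f02 f03 f12 f13 f23
    (by linear_combination e1) (by linear_combination e2) (by linear_combination e3)

/-! ### The equilibria and their variety -/

theorem asymmetricRelativeEquilibria_eq :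
    asymmetricRelativeEquilibria = vortexCurve '' asymmetricParameters := by
  apply Set.Subset.antisymm
  · intro p hp
    obtain ⟨t, ht, rfl⟩ := exists_parameter_of_mem_asymmetricRelativeEquilibria hp
    exact ⟨t, ht, rfl⟩
  · rintro _ ⟨t, ht, rfl⟩
    exact vortexCurve_mem_asymmetricRelativeEquilibria ht

theorem asymmetricParameters_subset : asymmetricParameters ⊆ {0}ᶜ := fun _ ht => ht.1

theorem asymmetricParameters_compl_finite : asymmetricParametersᶜ.Finite := by
  have hf : ∀ P : Polynomial ℝ, P.Monic → {t : ℝ | P.eval t = 0}.Finite := fun P hP =>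
    (P.roots.toFinset.finite_toSet).subset fun t ht => by
      simpa [hP.ne_zero] using ht
  -- The three factors are the excluded conditions `t = 0`, `t = t⁻¹` and `(t - t⁻¹)² = 1` with
  -- denominators cleared.
  have hP : (Polynomial.X * (Polynomial.X ^ 2 - 1) *
      ((Polynomial.X ^ 2 - 1) ^ 2 - Polynomial.X ^ 2) : Polynomial ℝ).Monic := by
    have h1 : (Polynomial.X ^ 2 - 1 : Polynomial ℝ).Monic := by monicity!
    have h2 : ((Polynomial.X ^ 2 - 1) ^ 2 - Polynomial.X ^ 2 : Polynomial ℝ).Monic := by monicity!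
    exact (Polynomial.monic_X.mul h1).mul h2
  refine (hf _ hP).subset fun t ht => ?_
  by_contra h
  apply ht
  simp at h
  refine ⟨h.1.1, fun h0 => h.1.2 ?_, fun h0 => h.2 ?_⟩
  · have := h.1.1
    field_simp at h0
    linarith
  · have := h.1.1
    field_simp at h0
    linarith

theorem isOpen_asymmetricParameters : IsOpen asymmetricParameters := by
  rw [← compl_compl asymmetricParameters]
  exact asymmetricParameters_compl_finite.isClosed.isOpen_compl

theorem dense_asymmetricParameters : Dense asymmetricParameters := by
  rw [← compl_compl asymmetricParameters]
  exact asymmetricParameters_compl_finite.countable.dense_compl ℝ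

theorem varietyOf_asymmetricRelativeEquilibria :
    varietyOf asymmetricRelativeEquilibria = vortexCurve '' {0}ᶜ := by
  rw [asymmetricRelativeEquilibria_eq]
  exact varietyOf_vortexCurve_image asymmetricParameters_subset
    (by rw [dense_asymmetricParameters.closure_eq]; exact Set.subset_univ _)

theorem mainTheorem10 :
    varietyDim (varietyOf asymmetricRelativeEquilibria) = 1 ∧
    (∀ p, ¬ IsSingularPoint (varietyOf asymmetricRelativeEquilibria) p) ∧
    IsSmoothSubmanifold 1 (varietyOf asymmetricRelativeEquilibria) ∧
    IsSmoothSubmanifold 1 asymmetricRelativeEquilibria := by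
  rw [varietyOf_asymmetricRelativeEquilibria]
  refine ⟨varietyDim_vortexCurve, ?_,
    isSmoothSubmanifold_vortexCurve_image isOpen_compl_singleton subset_rfl, ?_⟩
  · rintro _ ⟨⟨t, ht, rfl⟩, h⟩
    rw [finrank_zariskiTangentSpace_vortexCurve ht, varietyDim_vortexCurve] at h
    exact h rfl
  · rw [asymmetricRelativeEquilibria_eq]
    exact isSmoothSubmanifold_vortexCurve_image isOpen_asymmetricParameters
      asymmetricParameters_subset
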